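/- **Setting.** Let $n_1,\dots,n_K\ge 2$ be cluster sizes, $n=\sum_{k=1}^K n_k$, and let $C\in\mathbb{R}^{n\times n}$ be a positive definite block correlation matrix: $C$ has unit diagonal and the correlation between two distinct variables, one in cluster $k$ and one in cluster $l$, is $\rho_{kl}$ (variables are ordered by cluster). Put $A_{kl}=\rho_{kl}\sqrt{n_kn_l}$ for $k\neq l$, $A_{kk}=1+(n_k-1)\rho_{kk}$ and $\lambda_k=(n_k-A_{kk})/(n_k-1)$. For each $k$ let $v_{n_k}=(1/\sqrt{n_k},\dots,1/\sqrt{n_k})'\in\mathbb{R}^{n_k}$, let $v_{n_k}^{\perp}$ be any $n_k\times(n_k-1)$ matrix with $v_{n_k}'v_{n_k}^{\perp}=0$ and $v_{n_k}^{\perp\prime}v_{n_k}^{\perp}=I_{n_k-1}$, and let $Q=\big[\operatorname{diag}(v_{n_1},\dots,v_{n_K}),\ \operatorname{diag}(v_{n_1}^{\perp},\dots,v_{n_K}^{\perp})\big]$ (block diagonal parts). The correlation matrix is parametrized by $A\in\mathbb{R}^{K\times K}$ through $C(A)=Q\,\operatorname{diag}(A,\lambda_1I_{n_1-1},\dots,\lambda_KI_{n_K-1})\,Q'$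 with $\lambda_k=(n_k-A_{kk})/(n_k-1)$, and $C=C(A)$ at the value of $A$ given above. For a data vector $Z\in\mathbb{R}^n$ write $Q'Z=(Y_0',Y_1',\dots,Y_K')'$ with $Y_0\in\mathbb{R}^K$, $Y_k\in\mathbb{R}^{n_k-1}$, and $X_0=A^{-1/2}Y_0$, $X_k=\lambda_k^{-1/2}Y_k$. **Notation.** $\operatorname{vec}$ stacks columns, $M_\otimes=M\otimes M$, $K_K$ is the commutation matrix ($K_K\operatorname{vec}(B)=\operatorname{vec}(B')$), $H_K=I_{K^2}+K_K$, and $E_d$ is the $K\times K^2$ matrix with $E_d\operatorname{vec}(B)=\operatorname{diag}(B)$. For $\nu>2$, $t^{\mathrm{std}}_\nu(0,\Sigma)$ is the distribution on $\mathbb{R}^n$ with density $$\frac{\Gamma(\frac{\nu+n}{2})}{\Gamma(\frac{\nu}{2})}[(\nu-2)\pi]^{-n/2}|\Sigma|^{-1/2}\Big[1+\tfrac{1}{\nu-2}x'\Sigma^{-1}x\Big]^{-\frac{\nu+n}{2}}.$$ If $\ell(Z)$ denotes the logarithm of the density of the model with $C=C(A)$, evaluated at $Z$ and seen as a function of the $K^2$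 entries of $A$ (varied independently of each other), then the score is $\nabla_A=\partial\ell(Z)/\partial\operatorname{vec}(A)$ and the information matrix is $\mathcal{I}_A=\mathbb{E}(\nabla_A\nabla_A')$. **Theorem.** Let $\nu>2$ and $Z\sim t^{\mathrm{std}}_\nu(0,C)$. Then $\ell(Z)$ is differentiable at $\operatorname{vec}(A)$, all entries of $\nabla_A\nabla_A'$ are integrable, and $$\nabla_A=\tfrac12 A_\otimes^{-1/2}\big[W\operatorname{vec}(X_0X_0')-\operatorname{vec}(I_K)\big]+\tfrac12E_d'S,$$ $$\mathcal{I}_A=\tfrac14\big[\phi A_\otimes^{-1}H_K+(\phi-1)\operatorname{vec}(A^{-1})\operatorname{vec}(A^{-1})'\big]+\tfrac{\phi}{2}E_d'\Xi E_d+\tfrac{1-\phi}{4}\big[\operatorname{vec}(A^{-1})\xi'E_d+E_d'\xi\operatorname{vec}(A^{-1})'-E_d'\xi\xi'E_d\big],$$ where $$\phi=\frac{\nu+n}{\nu+n+2},\qquad W=\frac{\nu+n}{\nu-2+X_0'X_0+\sum_{k=1}^KX_k'X_k},$$ $$S_k=\frac1{\lambda_k}-\frac{WX_k'X_k}{\lambda_k(n_k-1)},\qquad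 \xi_k=\lambda_k^{-1},\qquad \Xi_{kk}=\lambda_k^{-2}(n_k-1)^{-1},$$ $S,\xi\in\mathbb{R}^K$ and $\Xi$ is diagonal. If instead $Z\sim N(0,C)$ and $\ell$ is the Gaussian log-likelihood (the case $\nu=\infty$, $W=\phi=1$), then $\ell(Z)$ is differentiable at $\operatorname{vec}(A)$, the formula for $\nabla_A$ holds with $W=1$, all entries of $\nabla_A\nabla_A'$ are integrable, and $\mathcal{I}_A=\tfrac14A_\otimes^{-1}H_K+\tfrac12E_d'\Xi E_d$. -/

import Mathlib

open MeasureTheory ProbabilityTheory Matrix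
open scoped Kronecker MatrixOrder

namespace BlockCorr

noncomputable section

/-- The density of the standardized multivariate `t`-distribution `t_ν^std(0, Σ)` (`ν > 2`), scaled
so that `Σ` is its variance matrix:
`Γ((ν+n)/2)/Γ(ν/2) · [(ν-2)π]^(-n/2) · |Σ|^(-1/2) · [1 + x'Σ⁻¹x/(ν-2)]^(-(ν+n)/2)`. -/
def tStdDensity {ι : Type*} [Fintype ι] [DecidableEq ι] (ν : ℝ) (Sig : Matrix ι ι ℝ)
    (x : ι → ℝ) : ℝ :=
  Real.Gamma ((ν + Fintype.card ι) / 2) / Real.Gamma (ν / 2)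
    * ((ν - 2) * Real.pi) ^ (-(Fintype.card ι : ℝ) / 2)
    * Sig.det ^ (-(1 : ℝ) / 2)
    * (1 + 1 / (ν - 2) * (x ⬝ᵥ Sig⁻¹ *ᵥ x)) ^ (-(ν + Fintype.card ι) / 2)

/-- The distribution `t_ν^std(0, Σ)` on `ℝⁿ`. -/
def tStd {ι : Type*} [Fintype ι] [DecidableEq ι] (ν : ℝ) (Sig : Matrix ι ι ℝ) :
    Measure (EuclideanSpace ℝ ι) :=
  volume.withDensity fun x => ENNReal.ofReal (tStdDensity ν Sig x)

/-- The density `(2π)^(-n/2) |Σ|^(-1/2) exp(-x'Σ⁻¹x/2)` of the Gaussian distribution `N(0, Σ)`. -/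
def gaussDensity {ι : Type*} [Fintype ι] [DecidableEq ι] (Sig : Matrix ι ι ℝ)
    (x : ι → ℝ) : ℝ :=
  (2 * Real.pi) ^ (-(Fintype.card ι : ℝ) / 2) * Sig.det ^ (-(1 : ℝ) / 2)
    * Real.exp (-(1 / 2) * (x ⬝ᵥ Sig⁻¹ *ᵥ x))

/-- The commutation matrix: `K_K vec(B) = vec(B')`. -/
def commMat (K : ℕ) : Matrix (Fin K × Fin K) (Fin K × Fin K) ℝ :=
  Matrix.of fun p q => if q = p.swap then 1 else 0

theorem commMat_mulVec_vec {K : ℕ} (B : Matrix (Fin K) (Fin K) ℝ) :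
    commMat K *ᵥ vec B = vec Bᵀ := by
  ext p
  simp [commMat, Matrix.mulVec, dotProduct, vec, Prod.swap]

/-- `H_K = I + K_K`. -/
def HMat (K : ℕ) : Matrix (Fin K × Fin K) (Fin K × Fin K) ℝ := 1 + commMat K

/-- The elimination matrix `E_d`: `E_d vec(B) = diag(B)`. -/
def diagElim (K : ℕ) : Matrix (Fin K) (Fin K × Fin K) ℝ :=
  Matrix.of fun k p => if p = (k, k) then 1 else 0

theorem diagElim_mulVec_vec {K : ℕ} (B : Matrix (Fin K) (Fin K) ℝ) :
    diagElim K *ᵥ vec B = B.diag := by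
  ext k
  simp [diagElim, Matrix.mulVec, dotProduct, vec]

/-- The inverse of `vec`. -/
def unvec {K : ℕ} (a : Fin K × Fin K → ℝ) : Matrix (Fin K) (Fin K) ℝ :=
  Matrix.of fun i j => a (j, i)

theorem unvec_vec {K : ℕ} (B : Matrix (Fin K) (Fin K) ℝ) : unvec (vec B) = B := rfl

/-- `A^(-1/2)`, the inverse of the symmetric square root of `A`. -/
def invSqrt {K : ℕ} (A : Matrix (Fin K) (Fin K) ℝ) : Matrix (Fin K) (Fin K) ℝ :=
  (CFC.sqrt A)⁻¹

/-- The variables: the `i`-th variable of the `k`-th cluster is `⟨k, i⟩`. -/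
abbrev Var {K : ℕ} (n : Fin K → ℕ) : Type := Σ k : Fin K, Fin (n k)

/-- Coordinates of the canonical variables `(Y_0', Y_1', …, Y_K')'`, where `Y_0` has dimension `K`
and `Y_k` has dimension `n_k - 1`. -/
abbrev Canon {K : ℕ} (n : Fin K → ℕ) : Type := Fin K ⊕ (Σ k : Fin K, Fin (n k - 1))

/-- The matrix with unit diagonal in which the correlation between two distinct variables, of the
clusters `k` and `l`, is `ρ_{kl}`. -/
def blockCorr {K : ℕ} (n : Fin K → ℕ) (ρ : Matrix (Fin K) (Fin K) ℝ) :
    Matrix (Var n) (Var n) ℝ :=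
  Matrix.of fun i j => if i = j then 1 else ρ i.1 j.1

/-- `A_{kl} = ρ_{kl} √(n_k n_l)` for `k ≠ l`, `A_{kk} = 1 + (n_k - 1) ρ_{kk}`. -/
def canonA {K : ℕ} (n : Fin K → ℕ) (ρ : Matrix (Fin K) (Fin K) ℝ) :
    Matrix (Fin K) (Fin K) ℝ :=
  Matrix.of fun k l =>
    if k = l then 1 + ((n k : ℝ) - 1) * ρ k k else ρ k l * √((n k : ℝ) * (n l : ℝ))

/-- `λ_k = (n_k - A_{kk}) / (n_k - 1)`. -/
def lam {K : ℕ} (n : Fin K → ℕ) (A : Matrix (Fin K) (Fin K) ℝ) (k : Fin K) : ℝ :=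
  ((n k : ℝ) - A k k) / ((n k : ℝ) - 1)

/-- `D = diag(A, λ_1 I_{n_1 - 1}, …, λ_K I_{n_K - 1})`. -/
def canonD {K : ℕ} (n : Fin K → ℕ) (A : Matrix (Fin K) (Fin K) ℝ) :
    Matrix (Canon n) (Canon n) ℝ :=
  Matrix.fromBlocks A 0 0 (Matrix.diagonal fun j => lam n A j.1)

/-- `v_m = (1/√m, …, 1/√m)'`. -/
def unitVec (m : ℕ) : Fin m → ℝ := fun _ => 1 / √(m : ℝ)

/-- `N` is an admissible choice of `v_m^⊥`: its columns are orthonormal and orthogonal to `v_m`. -/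
structure IsPerp {m : ℕ} (N : Matrix (Fin m) (Fin (m - 1)) ℝ) : Prop where
  orthogonal : unitVec m ᵥ* N = 0
  orthonormal : Nᵀ * N = 1

/-- `Q`, whose first `K` columns are block diagonal with blocks `v_{n_k}` and whose other columns
are block diagonal with blocks `v_{n_k}^⊥`. -/
def canonQ {K : ℕ} (n : Fin K → ℕ) (vperp : ∀ k, Matrix (Fin (n k)) (Fin (n k - 1)) ℝ) :
    Matrix (Var n) (Canon n) ℝ :=
  Matrix.fromCols (Matrix.of fun i k => if i.1 = k then unitVec (n i.1) i.2 else 0)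
    (Matrix.blockDiagonal' vperp)

/-- The correlation matrix as a function of the parameter `A`: `C(A) = Q D(A) Q'`. -/
def corrOfA {K : ℕ} (n : Fin K → ℕ) (vperp : ∀ k, Matrix (Fin (n k)) (Fin (n k - 1)) ℝ)
    (A : Matrix (Fin K) (Fin K) ℝ) : Matrix (Var n) (Var n) ℝ :=
  canonQ n vperp * canonD n A * (canonQ n vperp)ᵀ

/-- The log-likelihood `ℓ(z)` of `t_ν^std(0, C(A))`, as a function of `vec(A)`. -/
def logLikT {K : ℕ} (n : Fin K → ℕ) (vperp : ∀ k, Matrix (Fin (n k)) (Fin (n k - 1)) ℝ)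
    (ν : ℝ) (z : Var n → ℝ) (a : Fin K × Fin K → ℝ) : ℝ :=
  Real.log (tStdDensity ν (corrOfA n vperp (unvec a)) z)

/-- The log-likelihood `ℓ(z)` of `N(0, C(A))`, as a function of `vec(A)`. -/
def logLikGauss {K : ℕ} (n : Fin K → ℕ) (vperp : ∀ k, Matrix (Fin (n k)) (Fin (n k - 1)) ℝ)
    (z : Var n → ℝ) (a : Fin K × Fin K → ℝ) : ℝ :=
  Real.log (gaussDensity (corrOfA n vperp (unvec a)) z)

/-- The score: the vector of partial derivatives `∂ℓ/∂vec(A)` at `a = vec(A)`. -/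
def score {K : ℕ} (ell : (Fin K × Fin K → ℝ) → ℝ) (a : Fin K × Fin K → ℝ) :
    Fin K × Fin K → ℝ :=
  fun p => fderiv ℝ ell a (Pi.single p 1)

/-- `X_0 = A^(-1/2) Y_0`, where `Y = Q'z`. -/
def X0 {K : ℕ} (n : Fin K → ℕ) (vperp : ∀ k, Matrix (Fin (n k)) (Fin (n k - 1)) ℝ)
    (A : Matrix (Fin K) (Fin K) ℝ) (z : Var n → ℝ) : Fin K → ℝ :=
  invSqrt A *ᵥ fun k => ((canonQ n vperp)ᵀ *ᵥ z) (Sum.inl k)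

/-- `X_k = λ_k^(-1/2) Y_k`, where `Y = Q'z`. -/
def X {K : ℕ} (n : Fin K → ℕ) (vperp : ∀ k, Matrix (Fin (n k)) (Fin (n k - 1)) ℝ)
    (A : Matrix (Fin K) (Fin K) ℝ) (z : Var n → ℝ) (k : Fin K) : Fin (n k - 1) → ℝ :=
  fun j => (√(lam n A k))⁻¹ * ((canonQ n vperp)ᵀ *ᵥ z) (Sum.inr ⟨k, j⟩)

/-- `W = (ν + n) / (ν - 2 + X_0'X_0 + ∑_k X_k'X_k)` with `n = ∑_k n_k`. -/
def W {K : ℕ} (n : Fin K → ℕ) (vperp : ∀ k, Matrix (Fin (n k)) (Fin (n k - 1)) ℝ)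
    (A : Matrix (Fin K) (Fin K) ℝ) (ν : ℝ) (z : Var n → ℝ) : ℝ :=
  (ν + ∑ k, (n k : ℝ)) /
    (ν - 2 + X0 n vperp A z ⬝ᵥ X0 n vperp A z + ∑ k, X n vperp A z k ⬝ᵥ X n vperp A z k)

/-- `S_k = 1/λ_k - w X_k'X_k / (λ_k (n_k - 1))`. -/
def S {K : ℕ} (n : Fin K → ℕ) (vperp : ∀ k, Matrix (Fin (n k)) (Fin (n k - 1)) ℝ)
    (A : Matrix (Fin K) (Fin K) ℝ) (w : ℝ) (z : Var n → ℝ) : Fin K → ℝ :=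
  fun k => 1 / lam n A k
    - w * (X n vperp A z k ⬝ᵥ X n vperp A z k) / (lam n A k * ((n k : ℝ) - 1))

/-- `ξ_k = λ_k⁻¹`. -/
def xi {K : ℕ} (n : Fin K → ℕ) (A : Matrix (Fin K) (Fin K) ℝ) : Fin K → ℝ :=
  fun k => (lam n A k)⁻¹

/-- The diagonal matrix with `Ξ_{kk} = λ_k⁻² (n_k - 1)⁻¹`. -/
def Xi {K : ℕ} (n : Fin K → ℕ) (A : Matrix (Fin K) (Fin K) ℝ) : Matrix (Fin K) (Fin K) ℝ :=
  Matrix.diagonal fun k => (lam n A k ^ 2)⁻¹ * ((n k : ℝ) - 1)⁻¹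

/-- `φ = (ν + n) / (ν + n + 2)` with `n = ∑_k n_k`. -/
def phi {K : ℕ} (n : Fin K → ℕ) (ν : ℝ) : ℝ :=
  (ν + ∑ k, (n k : ℝ)) / (ν + (∑ k, (n k : ℝ)) + 2)

end

end BlockCorr

open BlockCorr

namespace BlockCorr

/-! ### Derivatives of determinants, inverses and elliptical log-densities -/

section Calculus

variable {ι : Type*} [Fintype ι] [DecidableEq ι] {V : Type*} [NormedAddCommGroup V]
  [NormedSpace ℝ V]

/-! Since `Q` is orthogonal, the determinant and the quadratic form of `C(A)` are those of the block
diagonal `D(A)` evaluated at `y = Q'z` (`det_corrOfA`, `quadForm_inv_corrOfA`), and `D(A)` is affine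
in `vec A`. For a density `κ |D|^(-1/2) h(y'D⁻¹y)` with `w = -2h'/h`, the partial derivative in a
direction with `N = ∂D` is half of `w y'D⁻¹ND⁻¹y - tr(D⁻¹N)` (`score_elliptical`). Reading this
block by block gives the stated score (`canonScore_eq`).

The score is thus a centred weighted quadratic form in `y`, so the information matrix needs only
`E[w y_a y_b]` and `E[w² y_a y_b y_e y_g]`. Both come from Stein's identity `integral_stein`: there
are directions in which the density `f` has derivative `-w Y_a f` and `Y_b` has the constant
derivative `D_ab`. The test function `Y_b` gives `E[w y_a y_b] = D_ab`. With the test function `w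
Y_b Y_e Y_g`, differentiating `w` produces a multiple of `w²`, because as a function of the
quadratic form `w' = -(c/2) w²`. The identity therefore closes up to the factor `1 + c`, and the
fourth moments are `(1 + c)⁻¹` times the sum over the three pairings of the Gaussian case.

For the t-distribution `c = 2/(ν+n)`, so `(1 + c)⁻¹ = φ`; for the Gaussian `w = 1` and `c = 0`.
Contracting the pairings (`integral_quadForm_mul_quadForm`) and evaluating the traces in the two
blocks of `D` gives the information matrix (`information_of_moments`). -/

theorem differentiableAt_det {M : V → Matrix ι ι ℝ} {a : V}
    (hM : ∀ i j, DifferentiableAt ℝ (fun v => M v i j) a) :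
    DifferentiableAt ℝ (fun v => (M v).det) a := by
  simp only [Matrix.det_apply']
  refine DifferentiableAt.fun_sum fun σ _ => ?_
  refine DifferentiableAt.const_mul ?_ _
  exact (HasFDerivAt.finsetProd fun i _ => (hM (σ i) i).hasFDerivAt).differentiableAt

theorem differentiableAt_inv_apply {M : V → Matrix ι ι ℝ} {a : V}
    (hM : ∀ i j, DifferentiableAt ℝ (fun v => M v i j) a) (h0 : (M a).det ≠ 0) (i j : ι) :
    DifferentiableAt ℝ (fun v => (M v)⁻¹ i j) a := by
  simp only [Matrix.inv_def, Matrix.smul_apply, Ring.inverse_eq_inv', smul_eq_mul,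
    Matrix.adjugate_apply]
  refine ((differentiableAt_det hM).inv h0).mul (differentiableAt_det fun k l => ?_)
  simp only [Matrix.updateRow_apply]
  split_ifs
  · exact differentiableAt_const _
  · exact hM _ _

omit [DecidableEq ι] in
theorem differentiableAt_quadForm {M : V → Matrix ι ι ℝ} {a : V}
    (hM : ∀ i j, DifferentiableAt ℝ (fun v => M v i j) a) (x y : ι → ℝ) :
    DifferentiableAt ℝ (fun v => x ⬝ᵥ (M v) *ᵥ y) a := by
  simp only [dotProduct, Matrix.mulVec]
  refine DifferentiableAt.fun_sum fun i _ => DifferentiableAt.const_mul ?_ _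
  exact DifferentiableAt.fun_sum fun j _ => (hM _ _).mul_const _

/-- Factor out `det M`; what is left, `det(1 + tM⁻¹N)`, is the polynomial `1 + t tr(M⁻¹N) + O(t²)`.
Symmetry is not assumed, since the entries of `A` vary independently and the perturbed matrix is not
symmetric. -/
theorem hasDerivAt_det_line (M N : Matrix ι ι ℝ) (h0 : M.det ≠ 0) :
    HasDerivAt (fun t : ℝ => (M + t • N).det) (M.det * trace (M⁻¹ * N)) 0 := by
  have h : ∀ t : ℝ, (M + t • N).det = M.det * (1 + t • (M⁻¹ * N)).det := by
    intro t
    rw [← Matrix.det_mul, mul_add, mul_one, Matrix.mul_smul, ← mul_assoc,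
      Matrix.mul_nonsing_inv _ (isUnit_iff_ne_zero.2 h0), one_mul]
  simp only [h]
  refine HasDerivAt.const_mul _ ?_
  rw [show (fun t : ℝ => (1 + t • (M⁻¹ * N)).det) = _ from
    funext fun t => Matrix.det_one_add_smul t (M⁻¹ * N)]
  set P := (det (1 + (Polynomial.X : Polynomial ℝ) • (M⁻¹ * N).map Polynomial.C)).divX.divX
  have h1 : HasDerivAt (fun t : ℝ => 1 + trace (M⁻¹ * N) * t + P.eval t * t ^ 2)
      (0 + trace (M⁻¹ * N) * 1 + (P.derivative.eval 0 * 0 ^ 2 + P.eval 0 * (2 * 0 ^ 1 * 1))) 0 :=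
    (((hasDerivAt_const _ _)).add ((hasDerivAt_id _).const_mul _)).add
      ((P.hasDerivAt 0).mul ((hasDerivAt_id (0 : ℝ)).pow 2))
  simpa using h1

/-- Resolvent identity `(M+tN)⁻¹ = M⁻¹ - t M⁻¹N(M+tN)⁻¹`, valid for small `t`. The derivative of `t
g(t)` at `0` is `g(0)`, so only the differentiability of `g` is needed, not its derivative. -/
theorem hasDerivAt_quadForm_inv_line (M N : Matrix ι ι ℝ) (h0 : M.det ≠ 0) (y : ι → ℝ) :
    HasDerivAt (fun t : ℝ => y ⬝ᵥ (M + t • N)⁻¹ *ᵥ y) (-(y ⬝ᵥ (M⁻¹ * N * M⁻¹) *ᵥ y)) 0 := by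
  have hent : ∀ i j, DifferentiableAt ℝ (fun t : ℝ => (M + t • N) i j) 0 := by
    intro i j
    simp only [Matrix.add_apply, Matrix.smul_apply, smul_eq_mul]
    fun_prop
  have hev : ∀ᶠ t : ℝ in nhds 0, (M + t • N).det ≠ 0 :=
    (differentiableAt_det hent).continuousAt.eventually_ne (by simpa using h0)
  have hG : DifferentiableAt ℝ (fun t : ℝ => (y ᵥ* (M⁻¹ * N)) ⬝ᵥ (M + t • N)⁻¹ *ᵥ y) 0 :=
    differentiableAt_quadForm (fun i j => differentiableAt_inv_apply hent (by simpa using h0) i j)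
      _ _
  have h1 : HasDerivAt (fun t : ℝ => y ⬝ᵥ M⁻¹ *ᵥ y
      - t * ((y ᵥ* (M⁻¹ * N)) ⬝ᵥ (M + t • N)⁻¹ *ᵥ y)) _ 0 :=
    ((hasDerivAt_id (0 : ℝ)).mul hG.hasDerivAt).const_sub _
  refine (h1.congr_of_eventuallyEq ?_).congr_deriv ?_
  · filter_upwards [hev] with t ht
    have hinv : (M + t • N)⁻¹ = M⁻¹ - t • (M⁻¹ * N * (M + t • N)⁻¹) := by
      have h2 : M⁻¹ * ((M + t • N) * (M + t • N)⁻¹) = M⁻¹ := by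
        rw [Matrix.mul_nonsing_inv _ (isUnit_iff_ne_zero.2 ht), mul_one]
      rw [add_mul, mul_add, ← mul_assoc, Matrix.nonsing_inv_mul _ (isUnit_iff_ne_zero.2 h0),
        one_mul, Matrix.smul_mul, Matrix.mul_smul, ← mul_assoc] at h2
      exact eq_sub_of_add_eq h2
    conv_lhs => rw [hinv]
    rw [Matrix.sub_mulVec, dotProduct_sub, Matrix.smul_mulVec, dotProduct_smul,
      ← Matrix.mulVec_mulVec, Matrix.dotProduct_mulVec y (M⁻¹ * N), smul_eq_mul]
  · simp [← Matrix.mulVec_mulVec, Matrix.dotProduct_mulVec, Matrix.vecMul_vecMul]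

/-- Derivative along a line of the logarithm of an elliptical density in its scatter matrix. -/
theorem hasDerivAt_log_elliptical_line (M N : Matrix ι ι ℝ) (h0 : 0 < M.det) (y : ι → ℝ)
    {κ w : ℝ} (hκ : 0 < κ) {h : ℝ → ℝ} (hpos : 0 < h (y ⬝ᵥ M⁻¹ *ᵥ y))
    (hh : HasDerivAt h (-(w / 2) * h (y ⬝ᵥ M⁻¹ *ᵥ y)) (y ⬝ᵥ M⁻¹ *ᵥ y)) :
    HasDerivAt (fun t : ℝ => Real.log (κ * (M + t • N).det ^ (-(1 : ℝ) / 2)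
        * h (y ⬝ᵥ (M + t • N)⁻¹ *ᵥ y)))
      (1 / 2 * (w * (y ⬝ᵥ (M⁻¹ * N * M⁻¹) *ᵥ y) - trace (M⁻¹ * N))) 0 := by
  have hM0 : M + (0 : ℝ) • N = M := by simp
  have hd := hasDerivAt_det_line M N h0.ne'
  have hq := hasDerivAt_quadForm_inv_line M N h0.ne' y
  have hd' := hd.rpow_const (p := -(1 : ℝ) / 2) (Or.inl (by rw [hM0]; exact h0.ne'))
  have hh' := HasDerivAt.comp (h₂ := h) (0 : ℝ) (by rw [hM0]; exact hh) hq
  have hp : 0 < M.det ^ (-(1 : ℝ) / 2) := Real.rpow_pos_of_pos h0 _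
  have := ((hd'.const_mul κ).mul hh').log (by
    rw [show ∀ g g' : ℝ → ℝ, (g * g') 0 = g 0 * g' 0 from fun _ _ => rfl]
    simp only [Function.comp, hM0]; exact (mul_pos (mul_pos hκ hp) hpos).ne')
  refine this.congr_deriv ?_
  simp only [Function.comp, Pi.mul_apply, hM0]
  have e : M.det ^ (-(1 : ℝ) / 2 - 1) = M.det ^ (-(1 : ℝ) / 2) / M.det := by
    rw [Real.rpow_sub h0, Real.rpow_one]
  rw [e]
  field_simp
  ring

theorem differentiableAt_log_elliptical {M : V → Matrix ι ι ℝ} {a : V}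
    (hM : ∀ i j, DifferentiableAt ℝ (fun v => M v i j) a) (h0 : 0 < (M a).det) (y : ι → ℝ)
    {κ : ℝ} (hκ : 0 < κ) {h : ℝ → ℝ} (hpos : 0 < h (y ⬝ᵥ (M a)⁻¹ *ᵥ y))
    (hh : DifferentiableAt ℝ h (y ⬝ᵥ (M a)⁻¹ *ᵥ y)) :
    DifferentiableAt ℝ (fun v => Real.log (κ * (M v).det ^ (-(1 : ℝ) / 2)
        * h (y ⬝ᵥ (M v)⁻¹ *ᵥ y))) a := by
  have hp : 0 < (M a).det ^ (-(1 : ℝ) / 2) := Real.rpow_pos_of_pos h0 _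
  have hq := differentiableAt_quadForm (fun i j => differentiableAt_inv_apply hM h0.ne' i j) y y
  exact ((((differentiableAt_det hM).rpow_const (Or.inl h0.ne')).const_mul κ).mul
    (DifferentiableAt.comp a hh hq)).log (mul_pos (mul_pos hκ hp) hpos).ne'

end Calculus

/-! ### The canonical form of a block correlation matrix -/

section Structure

variable {K : ℕ} {n : Fin K → ℕ} {vperp : ∀ k, Matrix (Fin (n k)) (Fin (n k - 1)) ℝ}

theorem unitVec_dotProduct_self {m : ℕ} (hm : m ≠ 0) : unitVec m ⬝ᵥ unitVec m = 1 := by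
  have : (m : ℝ) ≠ 0 := by exact_mod_cast hm
  simp only [unitVec, dotProduct, Finset.sum_const, Finset.card_univ, Fintype.card_fin,
    nsmul_eq_mul]
  rw [div_mul_div_comm, Real.mul_self_sqrt (by positivity)]
  field_simp

theorem IsPerp.sum_col {m : ℕ} {N : Matrix (Fin m) (Fin (m - 1)) ℝ} (h : IsPerp N)
    (j : Fin (m - 1)) : ∑ i, N i j = 0 := by
  have hm : m ≠ 0 := by have := j.2; omega
  have h1 : (unitVec m ᵥ* N) j = 0 := by rw [h.orthogonal]; rfl
  have h0 : (√(m : ℝ)) ≠ 0 := by positivity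
  simp only [unitVec, Matrix.vecMul, dotProduct, ← Finset.mul_sum] at h1
  simpa [h0] using h1

theorem canonQ_transpose_mul_self (hn : ∀ k, 2 ≤ n k) (hperp : ∀ k, IsPerp (vperp k)) :
    (canonQ n vperp)ᵀ * canonQ n vperp = 1 := by
  ext a b
  rw [Matrix.mul_apply, Fintype.sum_sigma]
  rcases a with k | ⟨k, j⟩ <;> rcases b with l | ⟨l, j'⟩
  · simp only [canonQ, Matrix.transpose_apply, Matrix.fromCols_apply_inl, Matrix.of_apply]
    by_cases h : k = l
    · subst h
      rw [Finset.sum_eq_single k]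
      · simpa [dotProduct] using unitVec_dotProduct_self (m := n k) (by have := hn k; omega)
      · intro m _ hm; simp [hm]
      · simp
    · rw [Matrix.one_apply_ne (by simpa using h)]
      refine Finset.sum_eq_zero fun m _ => Finset.sum_eq_zero fun i _ => ?_
      by_cases hk : m = k
      · subst hk; simp [h]
      · simp [hk]
  · simp only [canonQ, Matrix.transpose_apply, Matrix.fromCols_apply_inl,
      Matrix.fromCols_apply_inr, Matrix.of_apply]
    rw [Matrix.one_apply_ne (by simp)]
    refine Finset.sum_eq_zero fun m _ => ?_
    by_cases hk : m = l
    · subst hk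
      have := (hperp m).sum_col j'
      simp only [Matrix.blockDiagonal'_apply_eq, unitVec, ite_mul, zero_mul]
      split_ifs
      · rw [← Finset.mul_sum, this, mul_zero]
      · simp
    · simp [Matrix.blockDiagonal'_apply_ne _ _ _ hk]
  · simp only [canonQ, Matrix.transpose_apply, Matrix.fromCols_apply_inl,
      Matrix.fromCols_apply_inr, Matrix.of_apply]
    rw [Matrix.one_apply_ne (by simp)]
    refine Finset.sum_eq_zero fun m _ => ?_
    by_cases hk : m = k
    · subst hk
      have := (hperp m).sum_col j
      simp only [Matrix.blockDiagonal'_apply_eq, unitVec, mul_ite, mul_zero]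
      split_ifs
      · rw [← Finset.sum_mul, this, zero_mul]
      · simp
    · simp [Matrix.blockDiagonal'_apply_ne _ _ _ hk]
  · simp only [canonQ, Matrix.transpose_apply, Matrix.fromCols_apply_inr]
    rw [Finset.sum_eq_single k]
    · by_cases h : k = l
      · subst h
        have := congrFun (congrFun (hperp k).orthonormal j) j'
        simp only [Matrix.blockDiagonal'_apply_eq]
        simp only [Matrix.mul_apply, Matrix.transpose_apply] at this
        rw [this]
        simp [Matrix.one_apply]
      · rw [Matrix.one_apply_ne (by simp; tauto)]
        exact Finset.sum_eq_zero fun i _ => by simp [Matrix.blockDiagonal'_apply_ne _ _ _ h]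
    · intro m _ hm
      exact Finset.sum_eq_zero fun i _ => by simp [Matrix.blockDiagonal'_apply_ne _ _ _ hm]
    · simp

theorem card_canon (hn : ∀ k, 2 ≤ n k) : Fintype.card (Canon n) = Fintype.card (Var n) := by
  have : Fintype.card (Canon n) = ∑ k : Fin K, (1 + (n k - 1)) := by
    simp [Finset.sum_add_distrib]
  rw [this, Fintype.card_sigma]
  refine Finset.sum_congr rfl fun k _ => ?_
  have := hn k
  simp; omega

/-- Rows and columns of `Q` are indexed by different types; equality of their cardinalities turns
the left inverse into a right inverse. -/
theorem canonQ_mul_transpose_self (hn : ∀ k, 2 ≤ n k) (hperp : ∀ k, IsPerp (vperp k)) :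
    canonQ n vperp * (canonQ n vperp)ᵀ = 1 :=
  (Matrix.mul_eq_one_comm_of_equiv (Fintype.equivOfCardEq (card_canon hn))).1
    (canonQ_transpose_mul_self hn hperp)

theorem det_corrOfA (hn : ∀ k, 2 ≤ n k) (hperp : ∀ k, IsPerp (vperp k))
    (A : Matrix (Fin K) (Fin K) ℝ) : (corrOfA n vperp A).det = (canonD n A).det :=
  Matrix.det_conj_of_mul_eq_one (canonQ_mul_transpose_self hn hperp)
    (canonQ_transpose_mul_self hn hperp)

/-- No invertibility is assumed, so that the log-likelihood can be rewritten in canonical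
coordinates for every parameter value, not only near `vec A`. -/
theorem inv_corrOfA (hn : ∀ k, 2 ≤ n k) (hperp : ∀ k, IsPerp (vperp k))
    (A : Matrix (Fin K) (Fin K) ℝ) :
    (corrOfA n vperp A)⁻¹ = canonQ n vperp * (canonD n A)⁻¹ * (canonQ n vperp)ᵀ := by
  by_cases h : IsUnit (canonD n A).det
  · refine Matrix.inv_eq_right_inv ?_
    have := canonQ_transpose_mul_self hn hperp
    calc _ = canonQ n vperp * (canonD n A * ((canonQ n vperp)ᵀ * canonQ n vperp)
              * (canonD n A)⁻¹) * (canonQ n vperp)ᵀ := by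
            simp only [corrOfA, Matrix.mul_assoc]
      _ = 1 := by
            rw [this, Matrix.mul_one, Matrix.mul_nonsing_inv _ h, Matrix.mul_one,
              canonQ_mul_transpose_self hn hperp]
  -- Both matrices are singular together, and both inverses then have the default value `0`.
  · rw [Matrix.nonsing_inv_apply_not_isUnit _ h, Matrix.nonsing_inv_apply_not_isUnit _
      (by rwa [det_corrOfA hn hperp])]
    simp

theorem quadForm_inv_corrOfA (hn : ∀ k, 2 ≤ n k) (hperp : ∀ k, IsPerp (vperp k))
    (A : Matrix (Fin K) (Fin K) ℝ) (z : Var n → ℝ) :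
    z ⬝ᵥ (corrOfA n vperp A)⁻¹ *ᵥ z
      = ((canonQ n vperp)ᵀ *ᵥ z) ⬝ᵥ (canonD n A)⁻¹ *ᵥ ((canonQ n vperp)ᵀ *ᵥ z) := by
  rw [inv_corrOfA hn hperp, ← Matrix.mulVec_mulVec, ← Matrix.mulVec_mulVec,
    Matrix.dotProduct_mulVec, Matrix.mulVec_transpose]

theorem lam_canonA (hn : ∀ k, 2 ≤ n k) (ρ : Matrix (Fin K) (Fin K) ℝ) (k : Fin K) :
    lam n (canonA n ρ) k = 1 - ρ k k := by
  have : (2 : ℝ) ≤ n k := by exact_mod_cast hn k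
  have : (n k : ℝ) - 1 ≠ 0 := by linarith
  simp only [lam, canonA, Matrix.of_apply, if_true]
  field_simp
  ring

/-- It suffices to check `CQ = QD`. Block `(k,l)` of `C` is `ρ_kl 11'`, plus `(1-ρ_kk)I` when `k =
l`: it sends `v` to a multiple of `v`, and the columns of `v^⊥`, whose sums vanish, are eigenvectors
for `1 - ρ_kk = λ_k`. -/
theorem blockCorr_eq_corrOfA (hn : ∀ k, 2 ≤ n k) (hperp : ∀ k, IsPerp (vperp k))
    (ρ : Matrix (Fin K) (Fin K) ℝ) : blockCorr n ρ = corrOfA n vperp (canonA n ρ) := by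
  have key : blockCorr n ρ * canonQ n vperp = canonQ n vperp * canonD n (canonA n ρ) := by
    -- A row of `C` applied to a vector `f` supported on cluster `l`.
    have hsplit : ∀ (i : Var n) (l : Fin K) (f : Fin (n l) → ℝ),
        ∑ j, blockCorr n ρ i ⟨l, j⟩ * f j
          = ρ i.1 l * ∑ j, f j + (if h : i.1 = l then (1 - ρ l l) * f (h ▸ i.2) else 0) := by
      rintro ⟨k, i⟩ l f
      by_cases h : k = l
      · subst h
        simp only [blockCorr, Matrix.of_apply, Finset.mul_sum, dif_pos]
        rw [← Finset.add_sum_erase _ _ (Finset.mem_univ i),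
          ← Finset.add_sum_erase _ (fun j => ρ k k * f j) (Finset.mem_univ i)]
        have : ∑ j ∈ Finset.univ.erase i, (if (⟨k, i⟩ : Var n) = ⟨k, j⟩ then 1 else ρ k k) * f j
            = ∑ j ∈ Finset.univ.erase i, ρ k k * f j := by
          refine Finset.sum_congr rfl fun j hj => ?_
          have : i ≠ j := (Finset.ne_of_mem_erase hj).symm
          simp [this]
        rw [this]
        simp
        ring
      · simp only [blockCorr, Matrix.of_apply, Finset.mul_sum, dif_neg h, add_zero]
        refine Finset.sum_congr rfl fun j _ => ?_
        rw [if_neg]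
        intro h'
        exact h (congrArg Sigma.fst h')
    ext i b
    rw [Matrix.mul_apply, Fintype.sum_sigma, Matrix.mul_apply, Fintype.sum_sum_type]
    rcases b with l | ⟨l, j⟩
    · have hl : (0 : ℝ) < n l := by have := hn l; exact_mod_cast (by omega : 0 < n l)
      have hi : (0 : ℝ) < n i.1 := by have := hn i.1; exact_mod_cast (by omega : 0 < n i.1)
      have hsq := Real.mul_self_sqrt hl.le
      have hs : √(n l : ℝ) ≠ 0 := by positivity
      have hs' : √(n i.1 : ℝ) ≠ 0 := by positivity
      rw [Finset.sum_eq_single l]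
      · simp only [canonQ, canonD, Matrix.fromCols_apply_inl, Matrix.of_apply, if_true,
          Matrix.fromBlocks_apply₁₁, Matrix.fromBlocks_apply₂₁, Matrix.zero_apply, mul_zero,
          Finset.sum_const_zero, add_zero, ite_mul, zero_mul, Finset.sum_ite_eq,
          Finset.mem_univ, hsplit]
        simp only [unitVec, Finset.sum_const, Finset.card_univ, Fintype.card_fin, nsmul_eq_mul,
          canonA, Matrix.of_apply]
        by_cases h : i.1 = l
        · simp only [h, dif_pos, if_true]
          field_simp
          ring
        · simp only [h, dif_neg, if_false, not_false_eq_true, add_zero]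
          rw [Real.sqrt_mul hi.le]
          field_simp
          rw [pow_two, hsq]
      · intro m _ hm
        simp [canonQ, hm]
      · simp
    · rw [Finset.sum_eq_single l]
      · simp only [canonQ, canonD, Matrix.fromCols_apply_inr,
          Matrix.fromBlocks_apply₁₂, Matrix.fromBlocks_apply₂₂, Matrix.zero_apply, mul_zero,
          Finset.sum_const_zero, zero_add, Matrix.blockDiagonal'_apply_eq, hsplit,
          (hperp l).sum_col j]
        rw [Finset.sum_eq_single (⟨l, j⟩ : Σ k : Fin K, Fin (n k - 1))]
        · rw [Matrix.diagonal_apply_eq, lam_canonA hn]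
          rcases i with ⟨k, i⟩
          by_cases h : k = l
          · subst h
            simp [Matrix.blockDiagonal'_apply_eq, mul_comm]
          · simp [h, Matrix.blockDiagonal'_apply_ne _ _ _ h]
        · intro b _ hb
          rw [Matrix.diagonal_apply_ne _ hb, mul_zero]
        · simp
      · intro m _ hm
        exact Finset.sum_eq_zero fun i _ => by
          simp [canonQ, Matrix.blockDiagonal'_apply_ne _ _ _ hm]
      · simp
  rw [corrOfA, ← key, Matrix.mul_assoc, canonQ_mul_transpose_self hn hperp, Matrix.mul_one]

theorem transpose_mul_corrOfA_mul (hn : ∀ k, 2 ≤ n k) (hperp : ∀ k, IsPerp (vperp k))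
    (A : Matrix (Fin K) (Fin K) ℝ) :
    (canonQ n vperp)ᵀ * corrOfA n vperp A * canonQ n vperp = canonD n A := by
  calc _ = ((canonQ n vperp)ᵀ * canonQ n vperp) * canonD n A
          * ((canonQ n vperp)ᵀ * canonQ n vperp) := by simp only [corrOfA, Matrix.mul_assoc]
    _ = canonD n A := by
          rw [canonQ_transpose_mul_self hn hperp, Matrix.one_mul, Matrix.mul_one]

theorem posDef_canonD_of_corrOfA (hn : ∀ k, 2 ≤ n k) (hperp : ∀ k, IsPerp (vperp k))
    {A : Matrix (Fin K) (Fin K) ℝ} (h : (corrOfA n vperp A).PosDef) : (canonD n A).PosDef := by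
  rw [← transpose_mul_corrOfA_mul hn hperp A, ← Matrix.conjTranspose_eq_transpose_of_trivial]
  refine h.conjTranspose_mul_mul_same fun x y hxy => ?_
  have := congrArg ((canonQ n vperp)ᵀ *ᵥ ·) hxy
  simpa [Matrix.mulVec_mulVec, canonQ_transpose_mul_self hn hperp] using this

theorem posDef_of_canonD {A : Matrix (Fin K) (Fin K) ℝ} (h : (canonD n A).PosDef) :
    A.PosDef := by
  have := h.submatrix (e := (Sum.inl : Fin K → Canon n)) Sum.inl_injective
  rwa [show (canonD n A).submatrix Sum.inl Sum.inl = A from rfl] at this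

theorem lam_pos_of_canonD (hn : ∀ k, 2 ≤ n k) {A : Matrix (Fin K) (Fin K) ℝ}
    (h : (canonD n A).PosDef) (k : Fin K) : 0 < lam n A k := by
  -- `λ_k` appears on the diagonal of `D` only because `n_k ≥ 2`.
  have := h.diag_pos (i := Sum.inr ⟨k, ⟨0, by have := hn k; omega⟩⟩)
  simpa [canonD] using this

theorem inv_canonD {A : Matrix (Fin K) (Fin K) ℝ} (hA : IsUnit A.det)
    (hl : ∀ k, lam n A k ≠ 0) :
    (canonD n A)⁻¹ = Matrix.fromBlocks A⁻¹ 0 0 (Matrix.diagonal fun j => (lam n A j.1)⁻¹) := by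
  refine Matrix.inv_eq_right_inv ?_
  rw [canonD, Matrix.fromBlocks_multiply]
  simp [Matrix.mul_nonsing_inv _ hA, Matrix.diagonal_mul_diagonal, hl]

/-- The derivative of `canonD` in the direction of the entry `p` of `vec A`. -/
noncomputable def canonDeriv (n : Fin K → ℕ) (p : Fin K × Fin K) :
    Matrix (Canon n) (Canon n) ℝ :=
  Matrix.fromBlocks (Matrix.single p.2 p.1 1) 0 0
    (Matrix.diagonal fun j => if p = (j.1, j.1) then -((n j.1 : ℝ) - 1)⁻¹ else 0)

/-- Because `D` is affine in `vec A`, partial derivatives are derivatives along lines of matrices.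
As `vec` stacks columns, the index `p` is (column, row), hence the reversed order in `single p.2
p.1`. -/
theorem canonD_unvec_add_smul_single (n : Fin K → ℕ) (a : Fin K × Fin K → ℝ)
    (p : Fin K × Fin K) (t : ℝ) :
    canonD n (unvec (a + t • Pi.single p 1)) = canonD n (unvec a) + t • canonDeriv n p := by
  have h1 : unvec (a + t • Pi.single p 1) = unvec a + t • Matrix.single p.2 p.1 1 := by
    ext i j
    rcases p with ⟨p, q⟩
    simp only [unvec, Matrix.of_apply, Pi.add_apply, Pi.smul_apply, Matrix.add_apply,
      Matrix.smul_apply, Matrix.single_apply, Pi.single_apply, Prod.mk.injEq]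
    congr 2
    simp only [eq_comm, and_comm]
  rw [h1]
  simp only [canonD, canonDeriv, Matrix.fromBlocks_smul, Matrix.fromBlocks_add, smul_zero,
    add_zero]
  congr 1
  rw [← Matrix.diagonal_smul, Matrix.diagonal_add]
  congr 1
  ext j
  simp only [lam, Matrix.add_apply, Matrix.smul_apply, Matrix.single_apply, Pi.smul_apply,
    smul_eq_mul]
  rcases p with ⟨p, q⟩
  by_cases h : q = j.1 ∧ p = j.1
  · simp [h]; ring
  · have h' : ¬ ((p, q) = (j.1, j.1)) := by simp only [Prod.mk.injEq]; tauto
    simp [h, h']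

end Structure

/-! ### Weighted moments from integration by parts -/

section Moments

variable {E : Type*} [NormedAddCommGroup E] [NormedSpace ℝ E] [FiniteDimensional ℝ E]
  [MeasurableSpace E] [BorelSpace E] {μ : Measure E} [μ.IsAddHaarMeasure]
  {α : Type*} {f w : E → ℝ} {Y : α → E → ℝ} {d : α → E} {G : Matrix α α ℝ} {c : ℝ}

/-- Stein's identity for a density `f` whose derivative in the direction `v` is `-y f`. -/
theorem integral_stein {v : E} {y g g' : E → ℝ}
    (hf : ∀ x, HasLineDerivAt ℝ f (-(y x * f x)) x v)
    (hg : ∀ x, HasLineDerivAt ℝ g (g' x) x v)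
    (hfg : Integrable (fun x => f x * g x) μ) (hfg' : Integrable (fun x => f x * g' x) μ)
    (hyg : Integrable (fun x => y x * f x * g x) μ) :
    ∫ x, y x * f x * g x ∂μ = ∫ x, f x * g' x ∂μ := by
  have := integral_bilinear_hasLineDerivAt_right_eq_neg_left_of_integrable (μ := μ) (v := v)
    (f := f) (f' := fun x => -(y x * f x)) (g := g) (g' := g')
    (B := ContinuousLinearMap.mul ℝ ℝ) (by simpa using hyg.neg) (by simpa using hfg')
    (by simpa using hfg) (fun x _ => hf x) (fun x _ => hg x)
  simp only [ContinuousLinearMap.mul_apply', neg_mul, integral_neg, neg_neg] at this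
  exact this.symm

variable (hf : ∀ a x, HasLineDerivAt ℝ f (-(w x * Y a x * f x)) x (d a))
  (hw : ∀ a x, HasLineDerivAt ℝ w (-(c * w x ^ 2 * Y a x)) x (d a))
  (hY : ∀ a b x, HasLineDerivAt ℝ (Y b) (G a b) x (d a))
  (h0 : Integrable f μ) (h1 : ∀ a, Integrable (fun x => Y a x * f x) μ)
  (h2 : ∀ a b, Integrable (fun x => w x * Y a x * Y b x * f x) μ)
  (h3 : ∀ a b e, Integrable (fun x => w x * Y a x * Y b x * Y e x * f x) μ)
  (h4 : ∀ a b e g, Integrable (fun x => w x ^ 2 * (Y a x * Y b x) * (Y e x * Y g x) * f x) μ)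

include hf hY h0 h1 h2 in
-- Stein's identity in the direction `d a` with test function `Y b`, whose derivative is the
-- constant `G a b`.
theorem integral_weight_mul_mul (a b : α) :
    ∫ x, w x * Y a x * Y b x * f x ∂μ = G a b * ∫ x, f x ∂μ := by
  have := integral_stein (μ := μ) (hf a) (hY a b) ((h1 b).congr (ae_of_all _ fun x => by ring))
    (h0.mul_const _) ((h2 a b).congr (ae_of_all _ fun x => by ring))
  rw [integral_mul_const] at this
  rw [mul_comm (G a b), ← this]
  exact integral_congr_ae (ae_of_all _ fun x => by ring)

include hf hw hY h0 h1 h2 h3 h4 in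
-- Stein's identity with test function `w Y_b Y_e Y_g`. Differentiating `w` returns `-c` times the
-- integral sought, which accounts for `1 + c`; differentiating each `Y` leaves a second moment,
-- known from `integral_weight_mul_mul`.
theorem integral_weight_sq_mul_mul_mul_mul (a b e g : α) :
    (1 + c) * ∫ x, w x ^ 2 * (Y a x * Y b x) * (Y e x * Y g x) * f x ∂μ
      = (G a b * G e g + G a e * G b g + G a g * G b e) * ∫ x, f x ∂μ := by
  have hd : ∀ x, HasLineDerivAt ℝ (fun x => w x * Y b x * Y e x * Y g x)
      (-(c * (w x ^ 2 * (Y a x * Y b x) * (Y e x * Y g x))) + G a b * (w x * Y e x * Y g x)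
        + G a e * (w x * Y b x * Y g x) + G a g * (w x * Y b x * Y e x)) x (d a) := by
    intro x
    have := (((hw a x).mul (hY a b x)).mul (hY a e x)).mul (hY a g x)
    unfold HasLineDerivAt
    refine HasDerivAt.congr_deriv this ?_
    simp only [Pi.mul_apply, zero_smul, add_zero]
    ring
  have i4 := (h4 a b e g).const_mul (-c)
  have i1 := (h2 e g).const_mul (G a b)
  have i2 := (h2 b g).const_mul (G a e)
  have i3 := (h2 b e).const_mul (G a g)
  have := integral_stein (μ := μ) (hf a) hd ((h3 b e g).congr (ae_of_all _ fun x => by ring))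
    ((((i4.fun_add i1).fun_add i2).fun_add i3).congr (ae_of_all _ fun x => by ring))
    ((h4 a b e g).congr (ae_of_all _ fun x => by ring))
  have e1 : ∫ x, f x * (-(c * (w x ^ 2 * (Y a x * Y b x) * (Y e x * Y g x)))
        + G a b * (w x * Y e x * Y g x)
        + G a e * (w x * Y b x * Y g x) + G a g * (w x * Y b x * Y e x)) ∂μ
      = -c * (∫ x, w x ^ 2 * (Y a x * Y b x) * (Y e x * Y g x) * f x ∂μ)
        + G a b * (∫ x, w x * Y e x * Y g x * f x ∂μ)
        + G a e * (∫ x, w x * Y b x * Y g x * f x ∂μ)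
        + G a g * (∫ x, w x * Y b x * Y e x * f x ∂μ) := by
    simp only [← integral_const_mul]
    rw [← integral_add i4 i1, ← integral_add (i4.fun_add i1) i2,
      ← integral_add ((i4.fun_add i1).fun_add i2) i3]
    refine integral_congr_ae (ae_of_all _ fun x => ?_)
    ring
  have e2 : ∫ x, w x * Y a x * f x * (w x * Y b x * Y e x * Y g x) ∂μ
      = ∫ x, w x ^ 2 * (Y a x * Y b x) * (Y e x * Y g x) * f x ∂μ :=
    integral_congr_ae (ae_of_all _ fun x => by ring)
  rw [e1, e2] at this
  have hG := fun p q => integral_weight_mul_mul hf hY h0 h1 h2 p q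
  simp only [hG] at this
  linarith

end Moments

/-! ### The score in canonical coordinates -/

section Score

variable {K : ℕ} {n : Fin K → ℕ} {vperp : ∀ k, Matrix (Fin (n k)) (Fin (n k - 1)) ℝ}
  {A : Matrix (Fin K) (Fin K) ℝ}

theorem differentiable_canonD_unvec (n : Fin K → ℕ) (i j : Canon n) :
    Differentiable ℝ (fun a : Fin K × Fin K → ℝ => canonD n (unvec a) i j) := by
  rcases i with i | i <;> rcases j with j | j
  · simp only [canonD, Matrix.fromBlocks_apply₁₁, unvec, Matrix.of_apply]
    fun_prop
  · simp only [canonD, Matrix.fromBlocks_apply₁₂, Matrix.zero_apply]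
    fun_prop
  · simp only [canonD, Matrix.fromBlocks_apply₂₁, Matrix.zero_apply]
    fun_prop
  · simp only [canonD, Matrix.fromBlocks_apply₂₂, Matrix.diagonal_apply, lam, unvec,
      Matrix.of_apply]
    split_ifs <;> fun_prop

/-- The score of an elliptical model with weight `w` in terms of the canonical variables. -/
noncomputable def canonScore (n : Fin K → ℕ) (A : Matrix (Fin K) (Fin K) ℝ) (w : ℝ)
    (y : Canon n → ℝ) (p : Fin K × Fin K) : ℝ :=
  1 / 2 * (w * (y ⬝ᵥ ((canonD n A)⁻¹ * canonDeriv n p * (canonD n A)⁻¹) *ᵥ y)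
    - trace ((canonD n A)⁻¹ * canonDeriv n p))

/-- Fréchet differentiability lets each entry of the score be computed as a line derivative, where
the path of `D` is affine. The hypothesis `hh` says that `w` is `-2h'/h` at the observed quadratic
form. -/
theorem score_elliptical (hD : (canonD n A).PosDef) (y : Canon n → ℝ) {κ w : ℝ} (hκ : 0 < κ)
    {h : ℝ → ℝ} (hpos : 0 < h (y ⬝ᵥ (canonD n A)⁻¹ *ᵥ y))
    (hh : HasDerivAt h (-(w / 2) * h (y ⬝ᵥ (canonD n A)⁻¹ *ᵥ y)) (y ⬝ᵥ (canonD n A)⁻¹ *ᵥ y))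
    {ell : (Fin K × Fin K → ℝ) → ℝ}
    (hell : ∀ a, ell a = Real.log (κ * (canonD n (unvec a)).det ^ (-(1 : ℝ) / 2)
        * h (y ⬝ᵥ (canonD n (unvec a))⁻¹ *ᵥ y))) :
    DifferentiableAt ℝ ell (vec A) ∧ score ell (vec A) = canonScore n A w y := by
  have hd : DifferentiableAt ℝ ell (vec A) := by
    rw [show ell = _ from funext hell]
    exact differentiableAt_log_elliptical (M := fun a => canonD n (unvec a)) (a := vec A)
      (fun i j => (differentiable_canonD_unvec n i j).differentiableAt) hD.det_pos y hκ hpos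
      hh.differentiableAt
  refine ⟨hd, funext fun p => ?_⟩
  rw [score, ← hd.lineDeriv_eq_fderiv]
  refine HasLineDerivAt.lineDeriv ?_
  unfold HasLineDerivAt
  simp only [hell, canonD_unvec_add_smul_single, unvec_vec]
  exact hasDerivAt_log_elliptical_line (canonD n A) (canonDeriv n p) hD.det_pos y hκ hpos hh

theorem invSqrt_mul_self (hA : A.PosDef) : invSqrt A * invSqrt A = A⁻¹ := by
  rw [invSqrt, ← Matrix.mul_inv_rev, CFC.sqrt_mul_sqrt_self A hA.posSemidef.nonneg]

theorem invSqrt_transpose (A : Matrix (Fin K) (Fin K) ℝ) : (invSqrt A)ᵀ = invSqrt A := by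
  have h : (CFC.sqrt A).PosSemidef := Matrix.nonneg_iff_posSemidef.1 (CFC.sqrt_nonneg A)
  have := h.isHermitian
  rw [Matrix.IsHermitian, Matrix.conjTranspose_eq_transpose_of_trivial] at this
  rw [invSqrt, Matrix.transpose_nonsing_inv, this]

/-- The lower block contributes `n_k - 1` equal terms `-λ_k⁻¹(n_k-1)⁻¹`, and only when `p` is a
diagonal entry of `A`. -/
theorem trace_inv_canonD_mul_canonDeriv (hn : ∀ k, 2 ≤ n k) (hA : IsUnit A.det)
    (hl : ∀ k, lam n A k ≠ 0) (p : Fin K × Fin K) :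
    trace ((canonD n A)⁻¹ * canonDeriv n p)
      = A⁻¹ p.1 p.2 - if p.1 = p.2 then xi n A p.1 else 0 := by
  rw [inv_canonD hA hl, canonDeriv, Matrix.fromBlocks_multiply, Matrix.trace,
    Fintype.sum_sum_type]
  simp only [Matrix.zero_mul, Matrix.mul_zero, add_zero, zero_add, Matrix.diagonal_mul_diagonal,
    Matrix.diag_apply, Matrix.fromBlocks_apply₁₁, Matrix.fromBlocks_apply₂₂,
    Matrix.diagonal_apply_eq]
  rw [sub_eq_add_neg (A⁻¹ p.1 p.2)]
  congr 1
  · exact (Matrix.trace_mul_single _ _ _ _).trans (mul_one _)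
  · rw [Fintype.sum_sigma]
    rcases p with ⟨p, q⟩
    by_cases h : p = q
    · subst h
      have h2 : (2 : ℝ) ≤ n p := by exact_mod_cast hn p
      have h1 : (n p : ℝ) - 1 ≠ 0 := by linarith
      have h3 : 1 ≤ n p := by have := hn p; omega
      rw [Finset.sum_eq_single p]
      · simp only [xi, Nat.cast_sub h3, Finset.sum_const, Finset.card_univ, Fintype.card_fin,
          nsmul_eq_mul, if_true, Nat.cast_one]
        field_simp
      · intro b _ hb
        simp [hb.symm]
      · simp
    · have : ∀ k, ¬ ((p, q) = (k, k)) := by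
        intro k hk; simp only [Prod.mk.injEq] at hk; exact h (hk.1.trans hk.2.symm)
      simp [h, this]

theorem inv_mul_canonDeriv_mul_inv (hA : IsUnit A.det) (hl : ∀ k, lam n A k ≠ 0)
    (p : Fin K × Fin K) :
    (canonD n A)⁻¹ * canonDeriv n p * (canonD n A)⁻¹
      = Matrix.fromBlocks (A⁻¹ * Matrix.single p.2 p.1 1 * A⁻¹) 0 0
        (Matrix.diagonal fun j => if p = (j.1, j.1) then
          -((lam n A j.1 ^ 2)⁻¹ * ((n j.1 : ℝ) - 1)⁻¹) else 0) := by
  rw [inv_canonD hA hl, canonDeriv, Matrix.fromBlocks_multiply, Matrix.fromBlocks_multiply]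
  simp only [Matrix.zero_mul, Matrix.mul_zero, add_zero, zero_add, Matrix.diagonal_mul_diagonal]
  congr 2
  ext j
  split_ifs
  · have := hl j.1
    field_simp
  · simp

theorem quadForm_fromBlocks_diagonal (B : Matrix (Fin K) (Fin K) ℝ)
    (g : (Σ k : Fin K, Fin (n k - 1)) → ℝ) (y : Canon n → ℝ) :
    y ⬝ᵥ (Matrix.fromBlocks B 0 0 (Matrix.diagonal g)) *ᵥ y
      = (fun k => y (Sum.inl k)) ⬝ᵥ B *ᵥ (fun k => y (Sum.inl k))
        + ∑ k, ∑ j, g ⟨k, j⟩ * (y (Sum.inr ⟨k, j⟩) * y (Sum.inr ⟨k, j⟩)) := by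
  rw [Matrix.fromBlocks_mulVec, dotProduct, Fintype.sum_sum_type, ← Fintype.sum_sigma']
  simp only [Sum.elim_inl, Sum.elim_inr, Matrix.zero_mulVec, add_zero, zero_add,
    Matrix.mulVec_diagonal, Function.comp_def]
  congr 1
  exact Finset.sum_congr rfl fun j _ => by ring

theorem X0_dotProduct_self (hA : A.PosDef) (z : Var n → ℝ) :
    X0 n vperp A z ⬝ᵥ X0 n vperp A z
      = (fun k => ((canonQ n vperp)ᵀ *ᵥ z) (Sum.inl k)) ⬝ᵥ
        A⁻¹ *ᵥ (fun k => ((canonQ n vperp)ᵀ *ᵥ z) (Sum.inl k)) := by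
  rw [X0, ← invSqrt_mul_self hA, ← Matrix.mulVec_mulVec, Matrix.dotProduct_mulVec _ (invSqrt A),
    ← Matrix.mulVec_transpose, invSqrt_transpose, dotProduct_comm]

theorem X_dotProduct_self {k : Fin K} (hl : 0 < lam n A k) (z : Var n → ℝ) :
    X n vperp A z k ⬝ᵥ X n vperp A z k
      = ∑ j, (lam n A k)⁻¹ * (((canonQ n vperp)ᵀ *ᵥ z) (Sum.inr ⟨k, j⟩)
          * ((canonQ n vperp)ᵀ *ᵥ z) (Sum.inr ⟨k, j⟩)) := by
  simp only [X, dotProduct]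
  refine Finset.sum_congr rfl fun j _ => ?_
  rw [mul_mul_mul_comm, ← mul_inv, Real.mul_self_sqrt hl.le]

theorem sum_standardized_sq (hA : A.PosDef) (hl : ∀ k, 0 < lam n A k) (z : Var n → ℝ) :
    X0 n vperp A z ⬝ᵥ X0 n vperp A z + ∑ k, X n vperp A z k ⬝ᵥ X n vperp A z k
      = ((canonQ n vperp)ᵀ *ᵥ z) ⬝ᵥ (canonD n A)⁻¹ *ᵥ ((canonQ n vperp)ᵀ *ᵥ z) := by
  rw [inv_canonD hA.det_pos.ne'.isUnit (fun k => (hl k).ne'), quadForm_fromBlocks_diagonal,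
    X0_dotProduct_self hA]
  simp only [X_dotProduct_self (hl _)]

/-- The Kronecker factor turns `X_0X_0'` into `A⁻¹Y_0Y_0'A⁻¹` and `I` into `A⁻¹`, which is the upper
block of the canonical score. The lower block, present only at diagonal entries, is the `E_d'S`
term. -/
theorem canonScore_eq (hn : ∀ k, 2 ≤ n k) (hA : A.PosDef) (hl : ∀ k, 0 < lam n A k) (w : ℝ)
    (z : Var n → ℝ) :
    canonScore n A w ((canonQ n vperp)ᵀ *ᵥ z)
      = (1 / 2 : ℝ) • ((invSqrt A ⊗ₖ invSqrt A) *ᵥ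
            (w • vec (vecMulVec (X0 n vperp A z) (X0 n vperp A z))
              - vec (1 : Matrix (Fin K) (Fin K) ℝ)))
          + (1 / 2 : ℝ) • ((diagElim K)ᵀ *ᵥ S n vperp A w z) := by
  have hu := hA.det_pos.ne'.isUnit
  have hl' := fun k => (hl k).ne'
  have hAs : (A⁻¹)ᵀ = A⁻¹ := by
    rw [← invSqrt_mul_self hA, Matrix.transpose_mul, invSqrt_transpose]
  set y := (canonQ n vperp)ᵀ *ᵥ z with hy
  set y0 : Fin K → ℝ := fun k => y (Sum.inl k) with hy0
  have hX0 : invSqrt A *ᵥ X0 n vperp A z = A⁻¹ *ᵥ y0 := by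
    rw [X0, Matrix.mulVec_mulVec, invSqrt_mul_self hA]
  funext p
  rw [Pi.add_apply, Pi.smul_apply, Pi.smul_apply, ← Matrix.vec_smul, ← Matrix.vec_sub,
    Matrix.kronecker_mulVec_vec, invSqrt_transpose, Matrix.mul_sub, Matrix.sub_mul,
    Matrix.mul_one, invSqrt_mul_self hA, Matrix.mul_smul, Matrix.smul_mul,
    Matrix.mul_vecMulVec, Matrix.vecMulVec_mul, ← Matrix.mulVec_transpose, invSqrt_transpose, hX0,
    canonScore, inv_mul_canonDeriv_mul_inv hu hl',
    trace_inv_canonD_mul_canonDeriv hn hu hl', quadForm_fromBlocks_diagonal]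
  have hE : ((diagElim K)ᵀ *ᵥ S n vperp A w z) p
      = if p.1 = p.2 then S n vperp A w z p.1 else 0 := by
    rcases p with ⟨p, q⟩
    simp only [diagElim, Matrix.mulVec, dotProduct, Matrix.transpose_apply, Matrix.of_apply,
      ite_mul, one_mul, zero_mul, Prod.mk.injEq]
    by_cases h : p = q
    · subst h; simp
    · rw [if_neg h]
      refine Finset.sum_eq_zero fun k _ => if_neg ?_
      rintro ⟨rfl, rfl⟩; exact h rfl
  have h1 : y0 ⬝ᵥ (A⁻¹ * Matrix.single p.2 p.1 1 * A⁻¹) *ᵥ y0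
      = (A⁻¹ *ᵥ y0) p.2 * (A⁻¹ *ᵥ y0) p.1 := by
    rw [← Matrix.mulVec_mulVec, ← Matrix.mulVec_mulVec, Matrix.dotProduct_mulVec,
      ← Matrix.mulVec_transpose, hAs, Matrix.single_mulVec]
    simp [dotProduct, Function.update_apply]
  rw [hE, h1]
  -- The trace produces the entry `p.1 p.2`, whereas `vec A⁻¹` has `p.2 p.1` at `p`.
  have hsym : A⁻¹ p.1 p.2 = A⁻¹ p.2 p.1 := by
    conv_lhs => rw [← hAs]
    rfl
  rw [hsym]
  simp only [vec, Matrix.sub_apply, Matrix.smul_apply, vecMulVec_apply, smul_eq_mul]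
  have h2 : ∑ k, ∑ j : Fin (n k - 1), (if p = (k, k) then
        -((lam n A k ^ 2)⁻¹ * ((n k : ℝ) - 1)⁻¹) else 0)
          * (y (Sum.inr ⟨k, j⟩) * y (Sum.inr ⟨k, j⟩))
      = if p.1 = p.2 then -((X n vperp A z p.1 ⬝ᵥ X n vperp A z p.1)
          / (lam n A p.1 * ((n p.1 : ℝ) - 1))) else 0 := by
    rcases p with ⟨p, q⟩
    by_cases h : p = q
    · subst h
      rw [if_pos rfl, Finset.sum_eq_single p, X_dotProduct_self (hl p)]
      · simp only [if_true, ← Finset.mul_sum]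
        rw [div_eq_mul_inv, mul_inv]
        ring
      · intro b _ hb; simp [hb.symm]
      · simp
    · have : ∀ k, ¬ ((p, q) = (k, k)) := by
        intro k hk; simp only [Prod.mk.injEq] at hk; exact h (hk.1.trans hk.2.symm)
      simp [h, this]
  rw [h2]
  by_cases h : p.1 = p.2
  · simp only [h, if_true, S, xi]
    ring
  · simp only [h, if_false]
    ring

end Score

/-! ### Products of quadratic forms under the pairing formula -/

section QuadraticForms

variable {ι : Type*} [Fintype ι] {Ω : Type*} [MeasurableSpace Ω] {P : Measure Ω}
  {w : Ω → ℝ} {y : Ω → ι → ℝ} {D : Matrix ι ι ℝ} {φ : ℝ}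

theorem mul_quadForm_eq_sum (r : ℝ) (x : ι → ℝ) (M : Matrix ι ι ℝ) :
    r * (x ⬝ᵥ M *ᵥ x) = ∑ s : ι × ι, M s.1 s.2 * (r * x s.1 * x s.2) := by
  simp only [dotProduct, Matrix.mulVec, Finset.mul_sum, Fintype.sum_prod_type]
  refine Finset.sum_congr rfl fun a _ => Finset.sum_congr rfl fun b _ => by ring

theorem mul_quadForm_mul_mul_quadForm_eq_sum (r : ℝ) (x : ι → ℝ) (M N : Matrix ι ι ℝ) :
    (r * (x ⬝ᵥ M *ᵥ x)) * (r * (x ⬝ᵥ N *ᵥ x))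
      = ∑ s : ι × ι, ∑ t : ι × ι, (M s.1 s.2 * N t.1 t.2)
          * (r ^ 2 * (x s.1 * x s.2) * (x t.1 * x t.2)) := by
  rw [mul_quadForm_eq_sum, mul_quadForm_eq_sum, Finset.sum_mul_sum]
  refine Finset.sum_congr rfl fun a _ => Finset.sum_congr rfl fun b _ => by ring

theorem trace_transpose_mul_eq_sum (M D : Matrix ι ι ℝ) :
    trace (Mᵀ * D) = ∑ s : ι × ι, M s.1 s.2 * D s.1 s.2 := by
  simp only [Matrix.trace, Matrix.diag_apply, Matrix.mul_apply,
    Matrix.transpose_apply, Fintype.sum_prod_type]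
  exact Finset.sum_comm

variable (h2 : ∀ a b, Integrable (fun ω => w ω * y ω a * y ω b) P)
  (e2 : ∀ a b, ∫ ω, w ω * y ω a * y ω b ∂P = D a b)
  (h4 : ∀ a b c d, Integrable (fun ω => w ω ^ 2 * (y ω a * y ω b) * (y ω c * y ω d)) P)
  (e4 : ∀ a b c d, ∫ ω, w ω ^ 2 * (y ω a * y ω b) * (y ω c * y ω d) ∂P
    = φ * (D a b * D c d + D a c * D b d + D a d * D b c))

include h2 in
theorem integrable_quadForm (M : Matrix ι ι ℝ) :
    Integrable (fun ω => w ω * (y ω ⬝ᵥ M *ᵥ y ω)) P := by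
  simp only [mul_quadForm_eq_sum]
  exact integrable_finsetSum _ fun s _ => (h2 _ _).const_mul _

include h2 e2 in
theorem integral_quadForm (M : Matrix ι ι ℝ) :
    ∫ ω, w ω * (y ω ⬝ᵥ M *ᵥ y ω) ∂P = trace (Mᵀ * D) := by
  simp only [mul_quadForm_eq_sum]
  rw [integral_finsetSum _ fun s _ => (h2 _ _).const_mul _]
  simp only [integral_const_mul, e2, trace_transpose_mul_eq_sum]

include h4 in
theorem integrable_quadForm_mul_quadForm (M N : Matrix ι ι ℝ) :
    Integrable (fun ω => (w ω * (y ω ⬝ᵥ M *ᵥ y ω)) * (w ω * (y ω ⬝ᵥ N *ᵥ y ω))) P := by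
  simp only [mul_quadForm_mul_mul_quadForm_eq_sum]
  exact integrable_finsetSum _ fun s _ => integrable_finsetSum _ fun t _ =>
    (h4 _ _ _ _).const_mul _

include h4 e4 in
-- Each of the three pairings contracts to traces. The transposes matter: `M` and `N` will be `D⁻¹∂D
-- D⁻¹`, which is not symmetric for an off-diagonal entry of `A`.
theorem integral_quadForm_mul_quadForm (M N : Matrix ι ι ℝ) :
    ∫ ω, (w ω * (y ω ⬝ᵥ M *ᵥ y ω)) * (w ω * (y ω ⬝ᵥ N *ᵥ y ω)) ∂P
      = φ * (trace (Mᵀ * D) * trace (Nᵀ * D) + trace (Mᵀ * D * N * Dᵀ)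
        + trace (Mᵀ * D * Nᵀ * Dᵀ)) := by
  simp only [mul_quadForm_mul_mul_quadForm_eq_sum]
  rw [integral_finsetSum _ fun s _ => integrable_finsetSum _ fun t _ =>
    (h4 _ _ _ _).const_mul _]
  have : ∀ s : ι × ι, ∫ ω, ∑ t : ι × ι, (M s.1 s.2 * N t.1 t.2)
          * (w ω ^ 2 * (y ω s.1 * y ω s.2) * (y ω t.1 * y ω t.2)) ∂P
      = ∑ t : ι × ι, (M s.1 s.2 * N t.1 t.2)
          * (φ * (D s.1 s.2 * D t.1 t.2 + D s.1 t.1 * D s.2 t.2 + D s.1 t.2 * D s.2 t.1)) := by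
    intro s
    rw [integral_finsetSum _ fun t _ => (h4 _ _ _ _).const_mul _]
    simp only [integral_const_mul, e4]
  simp only [this]
  have s2 : ∀ N : Matrix ι ι ℝ, trace (Mᵀ * D * N * Dᵀ)
      = ∑ s : ι × ι, ∑ t : ι × ι, M s.1 s.2 * N t.1 t.2 * (D s.1 t.1 * D s.2 t.2) := by
    intro N
    rw [Matrix.mul_assoc, Matrix.mul_assoc, trace_transpose_mul_eq_sum]
    simp only [Matrix.mul_apply, Matrix.transpose_apply, Finset.mul_sum,
      Fintype.sum_prod_type]
    refine Finset.sum_congr rfl fun a _ => Finset.sum_congr rfl fun b _ =>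
      Finset.sum_congr rfl fun c _ => Finset.sum_congr rfl fun d _ => by ring
  -- The third pairing is the second one with `N` transposed.
  have s3 : trace (Mᵀ * D * Nᵀ * Dᵀ)
      = ∑ s : ι × ι, ∑ t : ι × ι, M s.1 s.2 * N t.1 t.2 * (D s.1 t.2 * D s.2 t.1) := by
    rw [s2]
    refine Finset.sum_congr rfl fun s _ => ?_
    rw [← (Equiv.prodComm ι ι).sum_comp]
    rfl
  rw [trace_transpose_mul_eq_sum, trace_transpose_mul_eq_sum, s2, s3, Finset.sum_mul_sum]
  simp only [← Finset.sum_add_distrib, Finset.mul_sum]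
  exact Finset.sum_congr rfl fun s _ => Finset.sum_congr rfl fun t _ => by ring

include h2 h4 in
theorem integrable_centered_quadForm_mul [IsFiniteMeasure P] (M N : Matrix ι ι ℝ) (u v : ℝ) :
    Integrable (fun ω => (1 / 2 * (w ω * (y ω ⬝ᵥ M *ᵥ y ω) - u))
      * (1 / 2 * (w ω * (y ω ⬝ᵥ N *ᵥ y ω) - v))) P := by
  have i1 := integrable_quadForm_mul_quadForm h4 M N
  have i2 := (integrable_quadForm h2 M).mul_const v
  have i3 := (integrable_quadForm h2 N).const_mul u
  refine ((((Integrable.sub i1 i2).sub i3).add (integrable_const (u * v))).const_mul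
    (1 / 4)).congr (ae_of_all _ fun ω => by
      simp only [Pi.add_apply, Pi.sub_apply]; ring)

include h2 h4 e2 e4 in
theorem integral_centered_quadForm_mul [IsProbabilityMeasure P] (M N : Matrix ι ι ℝ) (u v : ℝ) :
    ∫ ω, (1 / 2 * (w ω * (y ω ⬝ᵥ M *ᵥ y ω) - u))
      * (1 / 2 * (w ω * (y ω ⬝ᵥ N *ᵥ y ω) - v)) ∂P
      = 1 / 4 * (φ * (trace (Mᵀ * D) * trace (Nᵀ * D) + trace (Mᵀ * D * N * Dᵀ)
        + trace (Mᵀ * D * Nᵀ * Dᵀ)) - trace (Mᵀ * D) * v - u * trace (Nᵀ * D) + u * v) := by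
  have i1 := integrable_quadForm_mul_quadForm h4 M N
  have i2 := (integrable_quadForm h2 M).mul_const v
  have i3 := (integrable_quadForm h2 N).const_mul u
  have i12 : Integrable (fun ω => (w ω * (y ω ⬝ᵥ M *ᵥ y ω)) * (w ω * (y ω ⬝ᵥ N *ᵥ y ω))
    - w ω * (y ω ⬝ᵥ M *ᵥ y ω) * v) P := i1.sub i2
  have i123 : Integrable (fun ω => (w ω * (y ω ⬝ᵥ M *ᵥ y ω)) * (w ω * (y ω ⬝ᵥ N *ᵥ y ω))
    - w ω * (y ω ⬝ᵥ M *ᵥ y ω) * v - u * (w ω * (y ω ⬝ᵥ N *ᵥ y ω))) P := i12.sub i3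
  rw [← integral_quadForm_mul_quadForm h4 e4, ← integral_quadForm h2 e2, ← integral_quadForm h2 e2,
    ← integral_mul_const, ← integral_const_mul u, ← integral_sub i1 i2,
    ← integral_sub i12 i3]
  conv_rhs => rw [show u * v = ∫ _, u * v ∂P by simp]
  rw [← integral_add i123 (integrable_const (u * v)), ← integral_const_mul]
  exact integral_congr_ae (ae_of_all _ fun ω => by ring)

end QuadraticForms

/-! ### From moments to the information matrix -/

section Information

variable {K : ℕ} {n : Fin K → ℕ} {A : Matrix (Fin K) (Fin K) ℝ}

/-- The lower blocks of two derivatives overlap only if both belong to the same diagonal entry; then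
`n_k - 1` copies of `λ_k⁻²(n_k-1)⁻²` add up to `Ξ_kk`. -/
theorem trace_inv_canonD_mul_canonDeriv_mul (hn : ∀ k, 2 ≤ n k) (hA : IsUnit A.det)
    (hl : ∀ k, lam n A k ≠ 0) (p q : Fin K × Fin K) :
    trace ((canonD n A)⁻¹ * (canonDeriv n p)ᵀ * ((canonD n A)⁻¹ * canonDeriv n q))
      = A⁻¹ q.1 p.1 * A⁻¹ p.2 q.2
        + if p = q ∧ p.1 = p.2 then (lam n A p.1 ^ 2)⁻¹ * ((n p.1 : ℝ) - 1)⁻¹ else 0 := by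
  rw [inv_canonD hA hl, canonDeriv, canonDeriv, Matrix.fromBlocks_transpose,
    Matrix.fromBlocks_multiply, Matrix.fromBlocks_multiply, Matrix.fromBlocks_multiply,
    Matrix.trace, Fintype.sum_sum_type]
  simp only [Matrix.zero_mul, Matrix.mul_zero, add_zero, zero_add, Matrix.diagonal_mul_diagonal,
    Matrix.diag_apply, Matrix.fromBlocks_apply₁₁, Matrix.fromBlocks_apply₂₂,
    Matrix.diagonal_apply_eq, Matrix.diagonal_transpose, Matrix.transpose_zero,
    Matrix.transpose_single]
  congr 1
  · rw [← Matrix.mul_assoc]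
    refine ((Matrix.trace_mul_single _ _ _ _).trans (mul_one _)).trans ?_
    rw [Matrix.mul_assoc]
    simp [Matrix.mul_apply, Matrix.single_apply, ite_and]
  · rw [Fintype.sum_sigma]
    rcases p with ⟨p, p'⟩
    by_cases h : (p, p') = q ∧ p = p'
    · obtain ⟨rfl, rfl⟩ := h
      have h2 : (2 : ℝ) ≤ n p := by exact_mod_cast hn p
      have h1 : (n p : ℝ) - 1 ≠ 0 := by linarith
      have h3 : 1 ≤ n p := by have := hn p; omega
      rw [Finset.sum_eq_single p]
      · have := hl p
        simp only [Nat.cast_sub h3, Finset.sum_const, Finset.card_univ, Fintype.card_fin,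
          nsmul_eq_mul, if_true, Nat.cast_one, and_self]
        field_simp
      · intro b _ hb
        simp [hb.symm]
      · simp
    · rw [if_neg h]
      refine Finset.sum_eq_zero fun k _ => Finset.sum_eq_zero fun j _ => ?_
      by_cases h1 : (p, p') = (k, k)
      · by_cases h2 : q = (k, k)
        · refine absurd ⟨h1.trans h2.symm, ?_⟩ h
          simp only [Prod.mk.injEq] at h1
          exact h1.1.trans h1.2.symm
        · simp [h2]
      · simp [h1]

/-- The information matrix of an elliptical model whose weighted canonical variables have the
moments of an elliptical vector with scatter matrix `canonD n A`. -/
theorem information_of_moments (hn : ∀ k, 2 ≤ n k) (hD : (canonD n A).PosDef)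
    {Ω : Type*} [MeasurableSpace Ω] {P : Measure Ω} [IsProbabilityMeasure P]
    {w : Ω → ℝ} {y : Ω → Canon n → ℝ} {φ : ℝ}
    (h2 : ∀ a b, Integrable (fun ω => w ω * y ω a * y ω b) P)
    (e2 : ∀ a b, ∫ ω, w ω * y ω a * y ω b ∂P = canonD n A a b)
    (h4 : ∀ a b c d, Integrable (fun ω => w ω ^ 2 * (y ω a * y ω b) * (y ω c * y ω d)) P)
    (e4 : ∀ a b c d, ∫ ω, w ω ^ 2 * (y ω a * y ω b) * (y ω c * y ω d) ∂P
      = φ * (canonD n A a b * canonD n A c d + canonD n A a c * canonD n A b d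
        + canonD n A a d * canonD n A b c)) :
    (∀ p q, Integrable (fun ω => canonScore n A (w ω) (y ω) p
      * canonScore n A (w ω) (y ω) q) P) ∧
    (Matrix.of fun p q => ∫ ω, canonScore n A (w ω) (y ω) p
      * canonScore n A (w ω) (y ω) q ∂P) =
      (1 / 4 : ℝ) • (φ • ((A⁻¹ ⊗ₖ A⁻¹) * HMat K)
            + (φ - 1) • vecMulVec (vec A⁻¹) (vec A⁻¹))
          + (φ / 2) • ((diagElim K)ᵀ * Xi n A * diagElim K)
          + ((1 - φ) / 4) • (vecMulVec (vec A⁻¹) (xi n A) * diagElim K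
            + (diagElim K)ᵀ * vecMulVec (xi n A) (vec A⁻¹)
            - (diagElim K)ᵀ * vecMulVec (xi n A) (xi n A) * diagElim K) := by
  refine ⟨fun p q => integrable_centered_quadForm_mul h2 h4 _ _ _ _, ?_⟩
  have hA := posDef_of_canonD hD
  have hu := hA.det_pos.ne'.isUnit
  have hl' := fun k => (lam_pos_of_canonD hn hD k).ne'
  have hAs : ∀ i j, A⁻¹ i j = A⁻¹ j i := by
    intro i j
    have := hA.isHermitian.inv
    rw [Matrix.IsHermitian, Matrix.conjTranspose_eq_transpose_of_trivial] at this
    conv_lhs => rw [← this]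
    rfl
  have hDt : (canonD n A)ᵀ = canonD n A := by
    have := hD.isHermitian
    rwa [Matrix.IsHermitian, Matrix.conjTranspose_eq_transpose_of_trivial] at this
  have hDi : ((canonD n A)⁻¹)ᵀ = (canonD n A)⁻¹ := by rw [Matrix.transpose_nonsing_inv, hDt]
  have hDD := Matrix.nonsing_inv_mul _ hD.det_pos.ne'.isUnit
  have hEt : ∀ p, (canonDeriv n p)ᵀ = canonDeriv n p.swap := by
    rintro ⟨p, q⟩
    simp only [canonDeriv, Matrix.fromBlocks_transpose, Matrix.transpose_zero,
      Matrix.diagonal_transpose, Matrix.transpose_single, Prod.swap_prod_mk]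
    congr 2
    ext j
    simp only [Prod.mk.injEq, and_comm]
  ext p q
  rw [Matrix.of_apply]
  unfold canonScore
  rw [integral_centered_quadForm_mul h2 e2 h4 e4]
  have t1 : ∀ p, ((canonD n A)⁻¹ * canonDeriv n p * (canonD n A)⁻¹)ᵀ * canonD n A
      = (canonD n A)⁻¹ * (canonDeriv n p)ᵀ := by
    intro p
    rw [Matrix.transpose_mul, Matrix.transpose_mul, hDi, Matrix.mul_assoc, Matrix.mul_assoc, hDD,
      Matrix.mul_one]
  have t2 : ∀ p, trace ((canonD n A)⁻¹ * (canonDeriv n p)ᵀ)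
      = trace ((canonD n A)⁻¹ * canonDeriv n p) := by
    intro p
    rw [← Matrix.trace_transpose, Matrix.transpose_mul, hDi, Matrix.transpose_transpose,
      Matrix.trace_mul_comm]
  have t3 : ((canonD n A)⁻¹ * canonDeriv n q * (canonD n A)⁻¹)ᵀ
      = (canonD n A)⁻¹ * canonDeriv n q.swap * (canonD n A)⁻¹ := by
    rw [Matrix.transpose_mul, Matrix.transpose_mul, hDi, hEt, Matrix.mul_assoc]
  have t4 : ∀ q, (canonD n A)⁻¹ * (canonDeriv n p)ᵀ
        * ((canonD n A)⁻¹ * canonDeriv n q * (canonD n A)⁻¹) * (canonD n A)ᵀ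
      = (canonD n A)⁻¹ * (canonDeriv n p)ᵀ * ((canonD n A)⁻¹ * canonDeriv n q) := by
    intro q
    rw [hDt, Matrix.mul_assoc, Matrix.mul_assoc _ _ (canonD n A), hDD, Matrix.mul_one]
  -- The mean of each quadratic form equals its centring trace `τ_p`, so four times the entry is
  -- `φ(second + third pairing) + (φ-1) τ_p τ_q`. The two pairings, for `q` and `q.swap`, make up
  -- `A_⊗⁻¹H_K` and each yields one `Ξ`, whence `φ/2`. Expanding `τ_p`, which is `A⁻¹` minus `ξ` on
  -- diagonal entries, gives the terms with `φ-1` and `1-φ`.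
  rw [t1, t1, t2, t2, t3, t4, t4, trace_inv_canonD_mul_canonDeriv_mul hn hu hl',
    trace_inv_canonD_mul_canonDeriv_mul hn hu hl', trace_inv_canonD_mul_canonDeriv hn hu hl',
    trace_inv_canonD_mul_canonDeriv hn hu hl']
  have r1 : ((A⁻¹ ⊗ₖ A⁻¹) * HMat K) p q
      = A⁻¹ p.1 q.1 * A⁻¹ p.2 q.2 + A⁻¹ p.1 q.2 * A⁻¹ p.2 q.1 := by
    rw [HMat, Matrix.mul_add, Matrix.mul_one, Matrix.add_apply, Matrix.kronecker_apply,
      Matrix.mul_apply, Finset.sum_eq_single q.swap]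
    · simp [commMat]
    · intro r _ hr
      have : q ≠ r.swap := fun h => hr (by rw [h, Prod.swap_swap])
      simp [commMat, this]
    · simp
  have rE : ∀ (k : Fin K) (p : Fin K × Fin K),
      diagElim K k p = if p.1 = p.2 ∧ k = p.1 then 1 else 0 := by
    rintro k ⟨p, p'⟩
    simp only [diagElim, Matrix.of_apply, Prod.mk.injEq]
    congr 1
    simp only [eq_iff_iff]
    constructor
    · rintro ⟨rfl, rfl⟩; simp
    · rintro ⟨rfl, rfl⟩; simp
  have r2 : ∀ (m : Type) (B : Matrix m (Fin K) ℝ) (i : m) (p : Fin K × Fin K),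
      (B * diagElim K) i p = if p.1 = p.2 then B i p.1 else 0 := by
    intro m B i p
    rw [Matrix.mul_apply]
    simp only [rE]
    by_cases h : p.1 = p.2 <;> simp [h]
  have r3 : ∀ (m : Type) (B : Matrix (Fin K) m ℝ) (i : m) (p : Fin K × Fin K),
      ((diagElim K)ᵀ * B) p i = if p.1 = p.2 then B p.1 i else 0 := by
    intro m B i p
    rw [Matrix.mul_apply]
    simp only [rE, Matrix.transpose_apply]
    by_cases h : p.1 = p.2 <;> simp [h]
  simp only [Matrix.add_apply, Matrix.sub_apply, Matrix.smul_apply, smul_eq_mul, r1, r2, r3,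
    vecMulVec_apply, vec, Xi, Matrix.diagonal_apply, Prod.fst_swap, Prod.snd_swap]
  rcases p with ⟨p, p'⟩
  rcases q with ⟨q, q'⟩
  simp only [Prod.swap_prod_mk, Prod.mk.injEq]
  rw [hAs q p, hAs q' p, hAs p' p, hAs q' q]
  by_cases h1 : p = p'
  · subst h1
    by_cases h2 : q = q'
    · subst h2
      by_cases h3 : p = q
      · subst h3; simp only [and_self, if_true]; ring
      · simp only [h3, and_self, if_true, if_false, false_and]; ring
    · simp only [h2, if_true, if_false, and_true]
      rw [if_neg (by rintro ⟨rfl, rfl⟩; exact h2 rfl), if_neg (by rintro ⟨rfl, rfl⟩; exact h2 rfl)]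
      ring
  · simp only [h1, and_false, if_false]; split_ifs <;> ring

end Information

/-! ### Moments of an elliptical law -/

section EllipticalMoments

variable {ι κ : Type*} [Fintype ι] [DecidableEq ι] [Fintype κ]

omit [DecidableEq ι] in
theorem abs_transpose_mulVec_le (B : Matrix ι κ ℝ) :
    ∃ L : ℝ, 0 ≤ L ∧ ∀ (z : EuclideanSpace ℝ ι) (a : κ), |(Bᵀ *ᵥ z) a| ≤ L * ‖z‖ := by
  refine ⟨∑ a, ‖WithLp.toLp 2 (fun i => B i a)‖, by positivity, fun z a => ?_⟩
  have h1 : (Bᵀ *ᵥ z) a = inner ℝ (WithLp.toLp 2 (fun i => B i a)) z := by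
    simp [Matrix.mulVec, dotProduct, PiLp.inner_apply, mul_comm]
  rw [h1]
  refine (abs_real_inner_le_norm _ _).trans ?_
  gcongr
  exact Finset.single_le_sum (f := fun a => ‖WithLp.toLp 2 (fun i => B i a)‖)
    (fun _ _ => norm_nonneg _) (Finset.mem_univ a)

omit [DecidableEq ι] [Fintype κ] in
theorem continuous_transpose_mulVec (B : Matrix ι κ ℝ) (a : κ) :
    Continuous fun z : EuclideanSpace ℝ ι => (Bᵀ *ᵥ z) a := by
  simp only [Matrix.mulVec, dotProduct]
  fun_prop

omit [DecidableEq ι] in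
theorem continuous_quadForm (M : Matrix ι ι ℝ) :
    Continuous fun z : EuclideanSpace ℝ ι => z ⬝ᵥ M *ᵥ z := by
  simp only [Matrix.mulVec, dotProduct]
  fun_prop

omit [DecidableEq ι] in
theorem hasDerivAt_quadForm_line {M : Matrix ι ι ℝ} (hM : Mᵀ = M) (x v : ι → ℝ) :
    HasDerivAt (fun t : ℝ => (x + t • v) ⬝ᵥ M *ᵥ (x + t • v)) (2 * (x ⬝ᵥ M *ᵥ v)) 0 := by
  have hs : v ⬝ᵥ M *ᵥ x = x ⬝ᵥ M *ᵥ v := by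
    rw [Matrix.dotProduct_mulVec, ← Matrix.mulVec_transpose, hM, dotProduct_comm]
  have : ∀ t : ℝ, (x + t • v) ⬝ᵥ M *ᵥ (x + t • v)
      = x ⬝ᵥ M *ᵥ x + t * (2 * (x ⬝ᵥ M *ᵥ v)) + t ^ 2 * (v ⬝ᵥ M *ᵥ v) := by
    intro t
    simp only [Matrix.mulVec_add, Matrix.mulVec_smul, add_dotProduct, dotProduct_add,
      smul_dotProduct, dotProduct_smul, smul_eq_mul, hs]
    ring
  simp only [this]
  have h1 := (((hasDerivAt_id (0 : ℝ)).mul_const (2 * (x ⬝ᵥ M *ᵥ v))).const_add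
    (x ⬝ᵥ M *ᵥ x)).add (((hasDerivAt_id (0 : ℝ)).pow 2).mul_const (v ⬝ᵥ M *ᵥ v))
  refine h1.congr_deriv ?_
  simp

/-- Second and fourth order moments of an elliptical distribution weighted by the radial
function `w` for which `-w / 2` is the logarithmic derivative of the density generator. -/
theorem elliptical_moments {C : Matrix ι ι ℝ} (hC : C.PosDef) (B : Matrix ι κ ℝ) {k c : ℝ}
    (hk : 0 ≤ k) (hc : 0 ≤ c) {h w : ℝ → ℝ}
    (h_nonneg : ∀ q, 0 ≤ q → 0 ≤ h q)
    (hh : ∀ q, 0 ≤ q → HasDerivAt h (-(w q / 2) * h q) q)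
    (hw : ∀ q, 0 ≤ q → HasDerivAt w (-(c / 2) * w q ^ 2) q)
    {f : EuclideanSpace ℝ ι → ℝ} (hf : ∀ z, f z = k * h (z ⬝ᵥ C⁻¹ *ᵥ z))
    (i1 : Integrable fun z : EuclideanSpace ℝ ι => (1 + ‖z‖) * f z)
    (i3 : Integrable fun z : EuclideanSpace ℝ ι =>
      |w (z ⬝ᵥ C⁻¹ *ᵥ z)| * (1 + ‖z‖) ^ 3 * f z)
    (i4 : Integrable fun z : EuclideanSpace ℝ ι =>
      w (z ⬝ᵥ C⁻¹ *ᵥ z) ^ 2 * (1 + ‖z‖) ^ 4 * f z)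
    {m : Measure (EuclideanSpace ℝ ι)} [IsProbabilityMeasure m]
    (hm : m = volume.withDensity fun z => ENNReal.ofReal (f z)) :
    (∀ a b, Integrable (fun z : EuclideanSpace ℝ ι =>
        w (z ⬝ᵥ C⁻¹ *ᵥ z) * (Bᵀ *ᵥ z) a * (Bᵀ *ᵥ z) b) m) ∧
    (∀ a b, ∫ z : EuclideanSpace ℝ ι,
        w (z ⬝ᵥ C⁻¹ *ᵥ z) * (Bᵀ *ᵥ z) a * (Bᵀ *ᵥ z) b ∂m = (Bᵀ * C * B) a b) ∧
    (∀ a b e g, Integrable (fun z : EuclideanSpace ℝ ι => w (z ⬝ᵥ C⁻¹ *ᵥ z) ^ 2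
        * ((Bᵀ *ᵥ z) a * (Bᵀ *ᵥ z) b) * ((Bᵀ *ᵥ z) e * (Bᵀ *ᵥ z) g)) m) ∧
    (∀ a b e g, ∫ z : EuclideanSpace ℝ ι, w (z ⬝ᵥ C⁻¹ *ᵥ z) ^ 2
        * ((Bᵀ *ᵥ z) a * (Bᵀ *ᵥ z) b) * ((Bᵀ *ᵥ z) e * (Bᵀ *ᵥ z) g) ∂m
      = (1 + c)⁻¹ * ((Bᵀ * C * B) a b * (Bᵀ * C * B) e g
        + (Bᵀ * C * B) a e * (Bᵀ * C * B) b g + (Bᵀ * C * B) a g * (Bᵀ * C * B) b e)) := by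
  set G := Bᵀ * C * B with hG
  let q : EuclideanSpace ℝ ι → ℝ := fun z => z ⬝ᵥ C⁻¹ *ᵥ z
  let Y : κ → EuclideanSpace ℝ ι → ℝ := fun a z => (Bᵀ *ᵥ z) a
  -- The direction `CBe_a` cancels `C⁻¹` in the gradient `2C⁻¹z` of the quadratic form, whose
  -- derivative is then `2Y_a`; that of `Y_b` is the constant `G a b`.
  let d : κ → EuclideanSpace ℝ ι := fun a => WithLp.toLp 2 (fun i => (C * B) i a)
  have hCt : Cᵀ = C := by
    have := hC.isHermitian
    rwa [Matrix.IsHermitian, Matrix.conjTranspose_eq_transpose_of_trivial] at this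
  have hCit : (C⁻¹)ᵀ = C⁻¹ := by rw [Matrix.transpose_nonsing_inv, hCt]
  have hCC := Matrix.nonsing_inv_mul _ hC.det_pos.ne'.isUnit
  have hq0 : ∀ z, 0 ≤ q z := fun z => by
    simpa using hC.inv.posSemidef.dotProduct_mulVec_nonneg (z : ι → ℝ)
  have hf0 : ∀ z, 0 ≤ f z := fun z => by
    rw [hf]; exact mul_nonneg hk (h_nonneg _ (hq0 z))
  have hqc : Continuous q := continuous_quadForm _
  have hfc : Continuous f := by
    rw [show f = fun z => k * h (q z) from funext hf]
    exact continuous_const.mul (continuous_iff_continuousAt.2 fun z =>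
      ContinuousAt.comp (f := q) (hh _ (hq0 z)).continuousAt hqc.continuousAt)
  have hwc : Continuous fun z => w (q z) := continuous_iff_continuousAt.2 fun z =>
      ContinuousAt.comp (f := q) (hw _ (hq0 z)).continuousAt hqc.continuousAt
  have hYc : ∀ a, Continuous (Y a) := continuous_transpose_mulVec B
  obtain ⟨L, hL0, hL⟩ := abs_transpose_mulVec_le B
  have hYL : ∀ a z, |Y a z| ≤ L * (1 + ‖z‖) := fun a z =>
    (hL z a).trans (by gcongr; linarith)
  have hqd : ∀ a x, HasLineDerivAt ℝ q (2 * Y a x) x (d a) := by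
    intro a x
    have h1 := hasDerivAt_quadForm_line hCit (x : ι → ℝ) (d a)
    refine h1.congr_deriv ?_
    congr 1
    have : C⁻¹ *ᵥ (d a : ι → ℝ) = fun i => B i a := by
      ext i
      change (C⁻¹ * (C * B)) i a = B i a
      rw [← Matrix.mul_assoc, hCC, Matrix.one_mul]
    rw [this]
    simp [Y, Matrix.mulVec, dotProduct, mul_comm]
  have hYd : ∀ a b x, HasLineDerivAt ℝ (Y b) (G a b) x (d a) := by
    intro a b x
    have hGs : (Bᵀ *ᵥ (d a : ι → ℝ)) b = G a b := by
      change (Bᵀ * (C * B)) b a = G a b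
      rw [← Matrix.mul_assoc, ← Matrix.transpose_apply G, hG, Matrix.transpose_mul,
        Matrix.transpose_mul, hCt, Matrix.transpose_transpose, Matrix.mul_assoc]
    have : ∀ t : ℝ, Y b (x + t • d a) = Y b x + t * G a b := by
      intro t
      rw [← hGs]
      simp [Y, Matrix.mulVec_add, Matrix.mulVec_smul]
    unfold HasLineDerivAt
    simp only [this]
    simpa using ((hasDerivAt_id (0 : ℝ)).mul_const (G a b)).const_add (Y b x)
  have hfd : ∀ a x, HasLineDerivAt ℝ f (-(w (q x) * Y a x * f x)) x (d a) := by
    intro a x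
    rw [show f = fun z => k * h (q z) from funext hf]
    have h0 : q (x + (0 : ℝ) • d a) = q x := by simp
    have h1 := (HasDerivAt.comp (h₂ := h) (0 : ℝ) (by rw [h0]; exact hh _ (hq0 x))
      (hqd a x)).const_mul k
    exact h1.congr_deriv (by ring)
  have hwd : ∀ a x, HasLineDerivAt ℝ (fun z => w (q z)) (-(c * w (q x) ^ 2 * Y a x)) x (d a) := by
    intro a x
    have h0 : q (x + (0 : ℝ) • d a) = q x := by simp
    have h1 := HasDerivAt.comp (h₂ := w) (0 : ℝ) (by rw [h0]; exact hw _ (hq0 x)) (hqd a x)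
    exact h1.congr_deriv (by ring)
  have hs : ∀ z : EuclideanSpace ℝ ι, 1 ≤ 1 + ‖z‖ := fun z => by
    have := norm_nonneg z; linarith
  have j0 : Integrable f := i1.mono' hfc.aestronglyMeasurable (ae_of_all _ fun z => by
    rw [Real.norm_of_nonneg (hf0 z)]
    exact le_mul_of_one_le_left (hf0 z) (hs z))
  have j1 : ∀ a, Integrable (fun x => Y a x * f x) := fun a =>
    (i1.const_mul L).mono' ((hYc a).mul hfc).aestronglyMeasurable (ae_of_all _ fun z => by
      rw [Real.norm_eq_abs, abs_mul, abs_of_nonneg (hf0 z), ← mul_assoc]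
      exact mul_le_mul_of_nonneg_right (hYL a z) (hf0 z))
  have j3 : ∀ a b e, Integrable (fun x => w (q x) * Y a x * Y b x * Y e x * f x) := fun a b e =>
    (i3.const_mul (L ^ 3)).mono'
      ((((hwc.mul (hYc a)).mul (hYc b)).mul (hYc e)).mul hfc).aestronglyMeasurable
      (ae_of_all _ fun z => by
        rw [Real.norm_eq_abs, abs_mul, abs_mul, abs_mul, abs_mul, abs_of_nonneg (hf0 z),
          ← mul_assoc]
        refine mul_le_mul_of_nonneg_right ?_ (hf0 z)
        calc |w (q z)| * |Y a z| * |Y b z| * |Y e z|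
            ≤ |w (q z)| * (L * (1 + ‖z‖)) * (L * (1 + ‖z‖)) * (L * (1 + ‖z‖)) := by
              gcongr <;> exact hYL _ z
          _ = _ := by simp only [q]; ring)
  have j2 : ∀ a b, Integrable (fun x => w (q x) * Y a x * Y b x * f x) := fun a b =>
    (i3.const_mul (L ^ 2)).mono'
      (((hwc.mul (hYc a)).mul (hYc b)).mul hfc).aestronglyMeasurable
      (ae_of_all _ fun z => by
        rw [Real.norm_eq_abs, abs_mul, abs_mul, abs_mul, abs_of_nonneg (hf0 z),
          ← mul_assoc]
        refine mul_le_mul_of_nonneg_right ?_ (hf0 z)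
        calc |w (q z)| * |Y a z| * |Y b z|
            ≤ |w (q z)| * (L * (1 + ‖z‖)) * (L * (1 + ‖z‖)) := by
              gcongr <;> exact hYL _ z
          _ = L ^ 2 * (|w (q z)| * (1 + ‖z‖) ^ 2) := by ring
          _ ≤ _ := by
              gcongr
              · exact hs z
              · norm_num)
  have j4 : ∀ a b e g, Integrable
      (fun x => w (q x) ^ 2 * (Y a x * Y b x) * (Y e x * Y g x) * f x) := fun a b e g =>
    (i4.const_mul (L ^ 4)).mono'
      ((((hwc.pow 2).mul ((hYc a).mul (hYc b))).mul
        ((hYc e).mul (hYc g))).mul hfc).aestronglyMeasurable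
      (ae_of_all _ fun z => by
        rw [Real.norm_eq_abs, abs_mul, abs_mul, abs_mul, abs_mul, abs_mul,
          abs_of_nonneg (hf0 z), abs_of_nonneg (sq_nonneg (w (q z))), ← mul_assoc (L ^ 4)]
        refine mul_le_mul_of_nonneg_right ?_ (hf0 z)
        calc w (q z) ^ 2 * (|Y a z| * |Y b z|) * (|Y e z| * |Y g z|)
            ≤ w (q z) ^ 2 * ((L * (1 + ‖z‖)) * (L * (1 + ‖z‖)))
              * ((L * (1 + ‖z‖)) * (L * (1 + ‖z‖))) := by
              gcongr <;> exact hYL _ z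
          _ = _ := by simp only [q]; ring)
  have hmeas : Measurable fun z => ENNReal.ofReal (f z) := hfc.measurable.ennreal_ofReal
  have hlt : ∀ᵐ z ∂(volume : Measure (EuclideanSpace ℝ ι)), ENNReal.ofReal (f z) < ⊤ :=
    ae_of_all _ fun z => ENNReal.ofReal_lt_top
  have hint : ∀ g : EuclideanSpace ℝ ι → ℝ, ∫ z, g z ∂m = ∫ z, g z * f z := by
    intro g
    rw [hm, integral_withDensity_eq_integral_toReal_smul hmeas hlt]
    refine integral_congr_ae (ae_of_all _ fun z => ?_)
    simp only [ENNReal.toReal_ofReal (hf0 z), smul_eq_mul, mul_comm]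
  have hble : ∀ g : EuclideanSpace ℝ ι → ℝ, Integrable (fun z => g z * f z) →
      Integrable g m := by
    intro g hg
    rw [hm, integrable_withDensity_iff_integrable_smul' hmeas hlt]
    refine hg.congr (ae_of_all _ fun z => ?_)
    simp only [ENNReal.toReal_ofReal (hf0 z), smul_eq_mul, mul_comm]
  -- The normalization is read off from `m` being a probability measure; the constant `k` is never
  -- evaluated.
  have htot : ∫ z, f z = 1 := by
    have := hint fun _ => 1
    simpa using this.symm
  refine ⟨fun a b => hble _ (j2 a b), fun a b => ?_, fun a b e g => hble _ (j4 a b e g),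
    fun a b e g => ?_⟩
  · rw [hint]
    have := integral_weight_mul_mul hfd hYd j0 j1 j2 a b
    rwa [htot, mul_one] at this
  · rw [hint]
    have := integral_weight_sq_mul_mul_mul_mul hfd hwd hYd j0 j1 j2 j3 j4 a b e g
    rw [htot, mul_one] at this
    rw [← this, ← mul_assoc, inv_mul_cancel₀ (by positivity), one_mul]

end EllipticalMoments

/-! ### The standardized t-distribution -/

section StudentT

variable {ι κ : Type*} [Fintype ι] [DecidableEq ι] [Fintype κ]

omit [DecidableEq ι] in
-- Compactness of the unit sphere gives a positive lower bound there; homogeneity extends it.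
theorem exists_pos_mul_sq_norm_le_quadForm {M : Matrix ι ι ℝ} (hM : M.PosDef) :
    ∃ r : ℝ, 0 < r ∧ ∀ z : EuclideanSpace ℝ ι, r * ‖z‖ ^ 2 ≤ z ⬝ᵥ M *ᵥ z := by
  obtain ⟨r, hr, h⟩ := (isCompact_sphere (0 : EuclideanSpace ℝ ι) 1).exists_forall_le'
    (continuous_quadForm M).continuousOn (a := 0) (fun z hz => by
      have hz0 : (z : ι → ℝ) ≠ 0 := by
        intro h0
        have : z = 0 := by ext i; simpa using congrFun h0 i
        simp [this] at hz
      simpa using hM.dotProduct_mulVec_pos hz0)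
  refine ⟨r, hr, fun z => ?_⟩
  by_cases hz : z = 0
  · simp [hz]
  · have hn : ‖z‖ ≠ 0 := norm_ne_zero_iff.2 hz
    have h1 := h (‖z‖⁻¹ • z) (by simp [norm_smul, hn])
    simp only [WithLp.ofLp_smul, Matrix.mulVec_smul, smul_dotProduct,
      dotProduct_smul, smul_eq_mul] at h1
    have h2 : 0 < ‖z‖ ^ 2 := by positivity
    calc r * ‖z‖ ^ 2 ≤ (‖z‖⁻¹ * (‖z‖⁻¹ * (z ⬝ᵥ M *ᵥ z))) * ‖z‖ ^ 2 := by gcongr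
      _ = z ⬝ᵥ M *ᵥ z := by field_simp

theorem hasDerivAt_tGenerator {ν N q : ℝ} (hν : 2 < ν) (hq : 0 ≤ q) :
    HasDerivAt (fun q => (1 + 1 / (ν - 2) * q) ^ (-(ν + N) / 2))
      (-((ν + N) / (ν - 2 + q) / 2) * (1 + 1 / (ν - 2) * q) ^ (-(ν + N) / 2)) q := by
  have h1 : 0 < ν - 2 := by linarith
  have h2 : 0 < 1 + 1 / (ν - 2) * q := by positivity
  have h3 : ν - 2 + q ≠ 0 := by positivity
  have h := (((hasDerivAt_id q).const_mul (1 / (ν - 2))).const_add 1).rpow_const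
    (p := -(ν + N) / 2) (Or.inl h2.ne')
  refine h.congr_deriv ?_
  simp only [id]
  rw [Real.rpow_sub h2, Real.rpow_one]
  field_simp

/-- The equation `w' = -(c/2) w²` with `c = 2/(ν+N)`; this is the origin of `φ = (1 + c)⁻¹`. -/
theorem hasDerivAt_tWeight {ν N q : ℝ} (hν : 2 < ν) (hN : 0 ≤ N) (hq : 0 ≤ q) :
    HasDerivAt (fun q => (ν + N) / (ν - 2 + q))
      (-(2 / (ν + N) / 2) * ((ν + N) / (ν - 2 + q)) ^ 2) q := by
  have h1 : 0 < ν - 2 := by linarith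
  have h3 : ν - 2 + q ≠ 0 := by positivity
  have h4 : ν + N ≠ 0 := by positivity
  have h := (((hasDerivAt_id q).const_add (ν - 2)).inv h3).const_mul (ν + N)
  refine (h.congr_deriv ?_)
  simp only [id]
  field_simp

theorem tNormalizer_pos {ν N : ℝ} (hν : 2 < ν) (hN : 0 ≤ N) {Sig : Matrix ι ι ℝ}
    (hS : Sig.PosDef) :
    0 < Real.Gamma ((ν + N) / 2) / Real.Gamma (ν / 2) * ((ν - 2) * Real.pi) ^ (-N / 2)
      * Sig.det ^ (-(1 : ℝ) / 2) := by
  have h1 : 0 < (ν - 2) * Real.pi := mul_pos (by linarith) Real.pi_pos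
  have h2 := Real.Gamma_pos_of_pos (s := (ν + N) / 2) (by linarith)
  have h3 := Real.Gamma_pos_of_pos (s := ν / 2) (by linarith)
  have h4 := hS.det_pos
  positivity

/-- Fourth moments of `Z` need not exist for `ν > 2`, but `w (1+‖z‖)²` is bounded, so all weighted
integrands are dominated by a multiple of `(1+‖z‖) f`. -/
theorem tStd_moments {C : Matrix ι ι ℝ} (hC : C.PosDef) (B : Matrix ι κ ℝ) {ν : ℝ} (hν : 2 < ν)
    [IsProbabilityMeasure (tStd ν C)] {w : EuclideanSpace ℝ ι → ℝ}
    (hw : ∀ z, w z = (ν + Fintype.card ι) / (ν - 2 + z ⬝ᵥ C⁻¹ *ᵥ z)) :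
    (∀ a b, Integrable (fun z : EuclideanSpace ℝ ι =>
        w z * (Bᵀ *ᵥ z) a * (Bᵀ *ᵥ z) b) (tStd ν C)) ∧
    (∀ a b, ∫ z : EuclideanSpace ℝ ι,
        w z * (Bᵀ *ᵥ z) a * (Bᵀ *ᵥ z) b ∂(tStd ν C) = (Bᵀ * C * B) a b) ∧
    (∀ a b e g, Integrable (fun z : EuclideanSpace ℝ ι => w z ^ 2
        * ((Bᵀ *ᵥ z) a * (Bᵀ *ᵥ z) b) * ((Bᵀ *ᵥ z) e * (Bᵀ *ᵥ z) g)) (tStd ν C)) ∧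
    (∀ a b e g, ∫ z : EuclideanSpace ℝ ι, w z ^ 2
        * ((Bᵀ *ᵥ z) a * (Bᵀ *ᵥ z) b) * ((Bᵀ *ᵥ z) e * (Bᵀ *ᵥ z) g) ∂(tStd ν C)
      = (ν + Fintype.card ι) / (ν + Fintype.card ι + 2)
        * ((Bᵀ * C * B) a b * (Bᵀ * C * B) e g
        + (Bᵀ * C * B) a e * (Bᵀ * C * B) b g + (Bᵀ * C * B) a g * (Bᵀ * C * B) b e)) := by
  set N : ℝ := (Fintype.card ι : ℝ) with hN
  have hN0 : 0 ≤ N := Nat.cast_nonneg _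
  have hν2 : 0 < ν - 2 := by linarith
  have hνN : 0 < ν + N := by linarith
  have hφ : (ν + N) / (ν + N + 2) = (1 + 2 / (ν + N))⁻¹ := by
    rw [show 1 + 2 / (ν + N) = (ν + N + 2) / (ν + N) by field_simp, inv_div]
  obtain ⟨r, hr, hrz⟩ := exists_pos_mul_sq_norm_le_quadForm hC.inv
  let q : EuclideanSpace ℝ ι → ℝ := fun z => z ⬝ᵥ C⁻¹ *ᵥ z
  have hq0 : ∀ z, 0 ≤ q z := fun z => (by positivity : 0 ≤ r * ‖z‖ ^ 2).trans (hrz z)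
  let k : ℝ := Real.Gamma ((ν + N) / 2) / Real.Gamma (ν / 2)
    * ((ν - 2) * Real.pi) ^ (-N / 2) * C.det ^ (-(1 : ℝ) / 2)
  have hk : 0 < k := tNormalizer_pos hν hN0 hC
  have hf : ∀ z : EuclideanSpace ℝ ι,
      tStdDensity ν C z = k * (1 + 1 / (ν - 2) * (z ⬝ᵥ C⁻¹ *ᵥ z)) ^ (-(ν + N) / 2) :=
    fun z => rfl
  have hbase : ∀ z, 0 < 1 + 1 / (ν - 2) * q z := fun z => by have := hq0 z; positivity
  have hf0 : ∀ z : EuclideanSpace ℝ ι, 0 ≤ tStdDensity ν C z := fun z => by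
    rw [hf]; exact mul_nonneg hk.le (Real.rpow_nonneg (hbase z).le _)
  have hqc : Continuous q := continuous_quadForm _
  have hfc : Continuous fun z : EuclideanSpace ℝ ι => tStdDensity ν C z := by
    simp only [hf]
    exact continuous_const.mul ((continuous_const.add (continuous_const.mul hqc)).rpow_const
      fun z => Or.inl (hbase z).ne')
  have hwc : Continuous fun z => (ν + N) / (ν - 2 + q z) :=
    continuous_const.div (continuous_const.add hqc) fun z => by have := hq0 z; positivity
  -- `(1+s)² ≤ 2(1+s²)` with `1 = (ν-2)⁻¹(ν-2)` and `s² ≤ r⁻¹q`.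
  obtain ⟨M, hM, hMz⟩ : ∃ M : ℝ, 0 < M ∧ ∀ z : EuclideanSpace ℝ ι,
      (1 + ‖z‖) ^ 2 ≤ M * (ν - 2 + q z) := by
    refine ⟨2 * ((ν - 2)⁻¹ + r⁻¹), by positivity, fun z => ?_⟩
    have h1 : ‖z‖ ^ 2 ≤ r⁻¹ * q z := by
      rw [← div_eq_inv_mul, le_div_iff₀ hr, mul_comm]; exact hrz z
    have h2 : (ν - 2)⁻¹ * (ν - 2) = 1 := inv_mul_cancel₀ hν2.ne'
    have h3 : 0 ≤ (ν - 2)⁻¹ * q z := mul_nonneg (by positivity) (hq0 z)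
    have h4 : 0 ≤ r⁻¹ * (ν - 2) := by positivity
    nlinarith [sq_nonneg (1 - ‖z‖)]
  have hfle : ∀ z : EuclideanSpace ℝ ι, (1 + ‖z‖) * tStdDensity ν C z
      ≤ k * (M * (ν - 2)) ^ ((ν + N) / 2) * (1 + ‖z‖) ^ (-(ν + N - 1)) := by
    intro z
    have hs : 0 < 1 + ‖z‖ := by positivity
    have h1 : (1 + ‖z‖) ^ 2 / (M * (ν - 2)) ≤ 1 + 1 / (ν - 2) * q z := by
      rw [div_le_iff₀ (by positivity)]
      refine (hMz z).trans (le_of_eq ?_)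
      field_simp
    have h2 : (1 + 1 / (ν - 2) * q z) ^ (-(ν + N) / 2)
        ≤ ((1 + ‖z‖) ^ 2 / (M * (ν - 2))) ^ (-(ν + N) / 2) :=
      Real.rpow_le_rpow_of_nonpos (by positivity) h1 (by linarith)
    have h3 : ((1 + ‖z‖) ^ 2 / (M * (ν - 2))) ^ (-(ν + N) / 2)
        = (M * (ν - 2)) ^ ((ν + N) / 2) * (1 + ‖z‖) ^ (-(ν + N)) := by
      rw [Real.div_rpow (by positivity) (by positivity), ← Real.rpow_natCast,
        ← Real.rpow_mul hs.le, neg_div, Real.rpow_neg (by positivity : 0 ≤ M * (ν - 2)),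
        div_inv_eq_mul, mul_comm]
      congr 2
      push_cast
      ring
    have h4 : (1 + ‖z‖) ^ (-(ν + N - 1)) = (1 + ‖z‖) * (1 + ‖z‖) ^ (-(ν + N)) := by
      rw [show -(ν + N - 1) = 1 + -(ν + N) by ring, Real.rpow_add hs, Real.rpow_one]
    rw [hf, h4]
    calc _ ≤ (1 + ‖z‖) * (k * ((M * (ν - 2)) ^ ((ν + N) / 2) * (1 + ‖z‖) ^ (-(ν + N)))) := by
          rw [← h3]; gcongr
      _ = _ := by ring
  have i1 : Integrable fun z : EuclideanSpace ℝ ι => (1 + ‖z‖) * tStdDensity ν C z := by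
    refine ((integrable_one_add_norm (μ := volume) (E := EuclideanSpace ℝ ι)
      (r := ν + N - 1) ?_).const_mul (k * (M * (ν - 2)) ^ ((ν + N) / 2))).mono'
      (by fun_prop) (ae_of_all _ fun z => ?_)
    -- The decay exponent `ν + N - 1` must exceed the dimension `N`.
    · rw [finrank_euclideanSpace]; linarith
    · rw [Real.norm_of_nonneg (mul_nonneg (by positivity) (hf0 z))]
      exact hfle z
  have hwle : ∀ z, |(ν + N) / (ν - 2 + q z)| * (1 + ‖z‖) ^ 2 ≤ (ν + N) * M := by
    intro z
    have h1 : 0 < ν - 2 + q z := by have := hq0 z; positivity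
    rw [abs_of_nonneg (by positivity), div_mul_eq_mul_div, div_le_iff₀ h1, mul_assoc]
    exact mul_le_mul_of_nonneg_left (hMz z) hνN.le
  have key := elliptical_moments hC B (k := k) (c := 2 / (ν + N)) hk.le (by positivity)
    (h := fun q => (1 + 1 / (ν - 2) * q) ^ (-(ν + N) / 2))
    (w := fun q => (ν + N) / (ν - 2 + q))
    (fun q hq => by positivity) (fun q hq => hasDerivAt_tGenerator hν hq)
    (fun q hq => hasDerivAt_tWeight hν hN0 hq)
    (f := fun z => tStdDensity ν C z) hf i1
    ((i1.const_mul ((ν + N) * M)).mono' (by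
        exact ((hwc.abs.mul (by fun_prop)).mul hfc).aestronglyMeasurable)
      (ae_of_all _ fun z => by
        rw [Real.norm_of_nonneg (mul_nonneg (by positivity) (hf0 z))]
        calc |(ν + N) / (ν - 2 + q z)| * (1 + ‖z‖) ^ 3 * tStdDensity ν C z
            = (|(ν + N) / (ν - 2 + q z)| * (1 + ‖z‖) ^ 2)
              * ((1 + ‖z‖) * tStdDensity ν C z) := by ring
          _ ≤ _ := mul_le_mul_of_nonneg_right (hwle z)
              (mul_nonneg (by positivity) (hf0 z))))
    ((i1.const_mul (((ν + N) * M) ^ 2)).mono' (by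
        exact (((hwc.pow 2).mul (by fun_prop)).mul hfc).aestronglyMeasurable)
      (ae_of_all _ fun z => by
        rw [Real.norm_of_nonneg (mul_nonneg (by positivity) (hf0 z))]
        calc ((ν + N) / (ν - 2 + q z)) ^ 2 * (1 + ‖z‖) ^ 4 * tStdDensity ν C z
            = (|(ν + N) / (ν - 2 + q z)| * (1 + ‖z‖) ^ 2) ^ 2 * tStdDensity ν C z := by
              rw [mul_pow, sq_abs]; ring
          _ ≤ ((ν + N) * M) ^ 2 * tStdDensity ν C z := by
              refine mul_le_mul_of_nonneg_right ?_ (hf0 z)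
              exact pow_le_pow_left₀ (by positivity) (hwle z) 2
          _ ≤ _ := by
              refine mul_le_mul_of_nonneg_left ?_ (by positivity)
              exact le_mul_of_one_le_left (hf0 z) (by have := norm_nonneg z; linarith)))
    (m := tStd ν C) rfl
  simp only [hw, hφ]
  exact key

end StudentT

/-! ### The standard Gaussian distribution -/

section Gaussian

variable {ι κ : Type*} [Fintype ι] [DecidableEq ι] [Fintype κ]

omit [DecidableEq ι] in
-- Two finite measures with the same characteristic function `exp(-‖t‖²/2)`; the Fourier integral of
-- the Gaussian contributes `(2π)^(n/2)`, which cancels the normalizing constant.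
theorem stdGaussian_eq_withDensity :
    stdGaussian (EuclideanSpace ℝ ι) = volume.withDensity fun z =>
      ENNReal.ofReal ((2 * Real.pi) ^ (-(Fintype.card ι : ℝ) / 2)
        * Real.exp (-(1 / 2) * ‖z‖ ^ 2)) := by
  set k : ℝ := (2 * Real.pi) ^ (-(Fintype.card ι : ℝ) / 2) with hk
  have hk0 : 0 < k := by positivity
  have hint : Integrable fun z : EuclideanSpace ℝ ι => k * Real.exp (-(1 / 2) * ‖z‖ ^ 2) := by
    have := (GaussianFourier.integrable_cexp_neg_mul_sq_norm_add (b := 1 / 2) (by norm_num) 0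
      (0 : EuclideanSpace ℝ ι)).re.const_mul k
    refine this.congr (ae_of_all _ fun z => ?_)
    have : Complex.exp (-(1 / 2) * (‖z‖ : ℂ) ^ 2
        + 0 * ((inner ℝ (0 : EuclideanSpace ℝ ι) z : ℝ) : ℂ))
        = ((Real.exp (-(1 / 2) * ‖z‖ ^ 2) : ℝ) : ℂ) := by
      push_cast; simp
    simp only [this, RCLike.re_to_complex, Complex.ofReal_re]
  have hfin : IsFiniteMeasure (volume.withDensity fun z : EuclideanSpace ℝ ι =>
      ENNReal.ofReal (k * Real.exp (-(1 / 2) * ‖z‖ ^ 2))) :=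
    isFiniteMeasure_withDensity_ofReal hint.2
  refine Measure.ext_of_charFun (funext fun t => ?_)
  rw [charFun_stdGaussian, charFun_apply, integral_withDensity_eq_integral_toReal_smul
    (by fun_prop) (ae_of_all _ fun z => ENNReal.ofReal_lt_top)]
  have h1 : ∀ z : EuclideanSpace ℝ ι,
      (ENNReal.ofReal (k * Real.exp (-(1 / 2) * ‖z‖ ^ 2))).toReal
        • Complex.exp ((inner ℝ z t : ℝ) * Complex.I)
      = (k : ℂ) * Complex.exp (-(1 / 2) * (‖z‖ : ℂ) ^ 2 + Complex.I * (inner ℝ t z : ℝ)) := by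
    intro z
    rw [ENNReal.toReal_ofReal (by positivity), Complex.real_smul, Complex.exp_add,
      real_inner_comm t z]
    push_cast
    ring_nf
  simp only [h1]
  rw [integral_const_mul, GaussianFourier.integral_cexp_neg_mul_sq_norm_add (by norm_num),
    finrank_euclideanSpace, ← mul_assoc]
  have h2 : (k : ℂ) * ((Real.pi : ℂ) / (1 / 2)) ^ ((Fintype.card ι : ℂ) / 2) = 1 := by
    have : ((Real.pi : ℂ) / (1 / 2)) ^ ((Fintype.card ι : ℂ) / 2)
        = (((2 * Real.pi) ^ ((Fintype.card ι : ℝ) / 2) : ℝ) : ℂ) := by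
      rw [Complex.ofReal_cpow (by positivity)]
      push_cast
      congr 1
      ring
    rw [this, ← Complex.ofReal_mul, hk, ← Real.rpow_add (by positivity), neg_div,
      neg_add_cancel, Real.rpow_zero, Complex.ofReal_one]
  rw [h2, one_mul, Complex.I_sq]
  congr 1
  ring

omit [DecidableEq ι] in
theorem integrable_one_add_norm_pow_stdGaussian (p : ℕ) :
    Integrable (fun z : EuclideanSpace ℝ ι => (1 + ‖z‖) ^ p)
      (stdGaussian (EuclideanSpace ℝ ι)) := by
  have h0 : MemLp (id : EuclideanSpace ℝ ι → EuclideanSpace ℝ ι) p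
      (stdGaussian (EuclideanSpace ℝ ι)) :=
    IsGaussian.memLp_id _ _ (ENNReal.natCast_ne_top p)
  have h1 := (memLp_const (1 : ℝ)).add h0.norm
  refine h1.integrable_norm_pow'.congr (ae_of_all _ fun z => ?_)
  simp only [Pi.add_apply, id, Real.norm_of_nonneg (add_nonneg zero_le_one (norm_nonneg z))]

/-- The case `C = 1`, `w = 1`, `c = 0` of `elliptical_moments`. -/
theorem stdGaussian_moments (B : Matrix ι κ ℝ) :
    (∀ a b, Integrable (fun z : EuclideanSpace ℝ ι =>
        (1 : ℝ) * (Bᵀ *ᵥ z) a * (Bᵀ *ᵥ z) b) (stdGaussian _)) ∧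
    (∀ a b, ∫ z : EuclideanSpace ℝ ι,
        (1 : ℝ) * (Bᵀ *ᵥ z) a * (Bᵀ *ᵥ z) b ∂(stdGaussian _) = (Bᵀ * B) a b) ∧
    (∀ a b e g, Integrable (fun z : EuclideanSpace ℝ ι => (1 : ℝ) ^ 2
        * ((Bᵀ *ᵥ z) a * (Bᵀ *ᵥ z) b) * ((Bᵀ *ᵥ z) e * (Bᵀ *ᵥ z) g)) (stdGaussian _)) ∧
    (∀ a b e g, ∫ z : EuclideanSpace ℝ ι, (1 : ℝ) ^ 2
        * ((Bᵀ *ᵥ z) a * (Bᵀ *ᵥ z) b) * ((Bᵀ *ᵥ z) e * (Bᵀ *ᵥ z) g) ∂(stdGaussian _)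
      = 1 * ((Bᵀ * B) a b * (Bᵀ * B) e g
        + (Bᵀ * B) a e * (Bᵀ * B) b g + (Bᵀ * B) a g * (Bᵀ * B) b e)) := by
  set k : ℝ := (2 * Real.pi) ^ (-(Fintype.card ι : ℝ) / 2) with hk
  have hk0 : 0 < k := by positivity
  let f : EuclideanSpace ℝ ι → ℝ := fun z => k * Real.exp (-(1 / 2) * ‖z‖ ^ 2)
  have hf0 : ∀ z, 0 ≤ f z := fun z => by positivity
  have hfc : Continuous f := by fun_prop
  have hm : stdGaussian (EuclideanSpace ℝ ι)
      = volume.withDensity fun z => ENNReal.ofReal (f z) := stdGaussian_eq_withDensity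
  have hnorm : ∀ z : EuclideanSpace ℝ ι, ‖z‖ ^ 2 = z ⬝ᵥ (1 : Matrix ι ι ℝ)⁻¹ *ᵥ z := by
    intro z
    rw [inv_one, Matrix.one_mulVec, EuclideanSpace.real_norm_sq_eq]
    simp [dotProduct, pow_two]
  have j4 : Integrable (fun z : EuclideanSpace ℝ ι => (1 + ‖z‖) ^ 4 * f z) := by
    have h2 := integrable_one_add_norm_pow_stdGaussian (ι := ι) 4
    rw [hm] at h2
    refine ((integrable_withDensity_iff_integrable_smul' hfc.measurable.ennreal_ofReal
      (ae_of_all _ fun z => ENNReal.ofReal_lt_top)).1 h2).congr (ae_of_all _ fun z => ?_)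
    simp only [ENNReal.toReal_ofReal (hf0 z), smul_eq_mul]
    rw [mul_comm]
  have hs : ∀ z : EuclideanSpace ℝ ι, 1 ≤ 1 + ‖z‖ := fun z => by
    have := norm_nonneg z; linarith
  have key := elliptical_moments (C := (1 : Matrix ι ι ℝ)) Matrix.PosDef.one B (k := k) (c := 0)
    hk0.le le_rfl (h := fun q => Real.exp (-(1 / 2) * q)) (w := fun _ => 1)
    (fun q _ => (Real.exp_pos _).le)
    (fun q _ => by
      have := ((hasDerivAt_id q).const_mul (-(1 / 2 : ℝ))).exp
      refine this.congr_deriv ?_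
      simp only [id]
      ring)
    (fun q _ => by simpa using hasDerivAt_const q (1 : ℝ))
    (f := f) (fun z => by simp only [f, hnorm])
    (j4.mono' (by fun_prop) (ae_of_all _ fun z => by
      rw [Real.norm_of_nonneg (mul_nonneg (by positivity) (hf0 z))]
      exact mul_le_mul_of_nonneg_right (le_self_pow₀ (hs z) (by norm_num)) (hf0 z)))
    (j4.mono' (by fun_prop) (ae_of_all _ fun z => by
      rw [Real.norm_of_nonneg (mul_nonneg (by positivity) (hf0 z)), abs_one, one_mul]
      exact mul_le_mul_of_nonneg_right (pow_le_pow_right₀ (hs z) (by norm_num)) (hf0 z)))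
    (j4.congr (ae_of_all _ fun z => by simp)) hm
  simpa only [Matrix.mul_one, add_zero, inv_one] using key

end Gaussian

/-! ### The general Gaussian distribution -/

section MultivariateGaussian

variable {ι κ : Type*} [Fintype ι] [DecidableEq ι] [Fintype κ]

/-- `N(0,C)` is the image of the standard Gaussian under `√C`, so this is `stdGaussian_moments` with
`√C B` in place of `B`; the density of `N(0,C)` is not needed. -/
theorem multivariateGaussian_moments {C : Matrix ι ι ℝ} (hC : C.PosSemidef) (B : Matrix ι κ ℝ) :
    (∀ a b, Integrable (fun z : EuclideanSpace ℝ ι =>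
        (1 : ℝ) * (Bᵀ *ᵥ z) a * (Bᵀ *ᵥ z) b) (multivariateGaussian 0 C)) ∧
    (∀ a b, ∫ z : EuclideanSpace ℝ ι,
        (1 : ℝ) * (Bᵀ *ᵥ z) a * (Bᵀ *ᵥ z) b ∂(multivariateGaussian 0 C) = (Bᵀ * C * B) a b) ∧
    (∀ a b e g, Integrable (fun z : EuclideanSpace ℝ ι => (1 : ℝ) ^ 2
        * ((Bᵀ *ᵥ z) a * (Bᵀ *ᵥ z) b) * ((Bᵀ *ᵥ z) e * (Bᵀ *ᵥ z) g))
        (multivariateGaussian 0 C)) ∧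
    (∀ a b e g, ∫ z : EuclideanSpace ℝ ι, (1 : ℝ) ^ 2
        * ((Bᵀ *ᵥ z) a * (Bᵀ *ᵥ z) b) * ((Bᵀ *ᵥ z) e * (Bᵀ *ᵥ z) g)
        ∂(multivariateGaussian 0 C)
      = 1 * ((Bᵀ * C * B) a b * (Bᵀ * C * B) e g
        + (Bᵀ * C * B) a e * (Bᵀ * C * B) b g + (Bᵀ * C * B) a g * (Bᵀ * C * B) b e)) := by
  let T : EuclideanSpace ℝ ι → EuclideanSpace ℝ ι :=
    fun x => 0 + toEuclideanCLM (𝕜 := ℝ) (CFC.sqrt C) x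
  have hT : AEMeasurable T (stdGaussian (EuclideanSpace ℝ ι)) := by
    have : Continuous T := by fun_prop
    exact this.aemeasurable
  have hm : multivariateGaussian 0 C = (stdGaussian (EuclideanSpace ℝ ι)).map T := rfl
  have hsym : (CFC.sqrt C)ᵀ = CFC.sqrt C := by
    have h : (CFC.sqrt C).PosSemidef := Matrix.nonneg_iff_posSemidef.1 (CFC.sqrt_nonneg C)
    have := h.isHermitian
    rwa [Matrix.IsHermitian, Matrix.conjTranspose_eq_transpose_of_trivial] at this
  have hB : (CFC.sqrt C * B)ᵀ * (CFC.sqrt C * B) = Bᵀ * C * B := by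
    conv_rhs => rw [← CFC.sqrt_mul_sqrt_self C hC.nonneg]
    rw [Matrix.transpose_mul, hsym]
    simp only [Matrix.mul_assoc]
  have hY : ∀ x a, (Bᵀ *ᵥ (T x)) a = ((CFC.sqrt C * B)ᵀ *ᵥ x) a := by
    intro x a
    simp only [T, zero_add, Matrix.ofLp_toEuclideanCLM, Matrix.mulVec_mulVec,
      Matrix.transpose_mul, hsym]
  have hc := continuous_transpose_mulVec B
  obtain ⟨h2, e2, h4, e4⟩ := stdGaussian_moments (CFC.sqrt C * B)
  simp only [hB, ← hY] at h2 e2 h4 e4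
  have c2 : ∀ a b, Continuous fun z : EuclideanSpace ℝ ι =>
      (1 : ℝ) * (Bᵀ *ᵥ z) a * (Bᵀ *ᵥ z) b := fun a b =>
    (continuous_const.mul (hc a)).mul (hc b)
  have c4 : ∀ a b e g, Continuous fun z : EuclideanSpace ℝ ι => (1 : ℝ) ^ 2
      * ((Bᵀ *ᵥ z) a * (Bᵀ *ᵥ z) b) * ((Bᵀ *ᵥ z) e * (Bᵀ *ᵥ z) g) := fun a b e g =>
    (continuous_const.mul ((hc a).mul (hc b))).mul ((hc e).mul (hc g))
  rw [hm]
  refine ⟨fun a b => ?_, fun a b => ?_, fun a b e g => ?_, fun a b e g => ?_⟩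
  · exact (integrable_map_measure (c2 a b).aestronglyMeasurable hT).2 (h2 a b)
  · rw [integral_map hT (c2 a b).aestronglyMeasurable]
    exact e2 a b
  · exact (integrable_map_measure (c4 a b e g).aestronglyMeasurable hT).2 (h4 a b e g)
  · rw [integral_map hT (c4 a b e g).aestronglyMeasurable]
    exact e4 a b e g

end MultivariateGaussian

/-! ### The two log-likelihoods -/

section LogLikelihood

variable {K : ℕ} {n : Fin K → ℕ} {vperp : ∀ k, Matrix (Fin (n k)) (Fin (n k - 1)) ℝ}
  {A : Matrix (Fin K) (Fin K) ℝ}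

theorem card_var (n : Fin K → ℕ) : (Fintype.card (Var n) : ℝ) = ∑ k, (n k : ℝ) := by
  simp

theorem W_eq (hn : ∀ k, 2 ≤ n k) (hperp : ∀ k, IsPerp (vperp k)) (hD : (canonD n A).PosDef)
    (ν : ℝ) (z : Var n → ℝ) :
    W n vperp A ν z = (ν + Fintype.card (Var n)) /
      (ν - 2 + z ⬝ᵥ (corrOfA n vperp A)⁻¹ *ᵥ z) := by
  rw [W, card_var, add_assoc (ν - 2), sum_standardized_sq (posDef_of_canonD hD)
    (lam_pos_of_canonD hn hD), quadForm_inv_corrOfA hn hperp]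

theorem quadForm_inv_canonD_nonneg (hD : (canonD n A).PosDef) (y : Canon n → ℝ) :
    0 ≤ y ⬝ᵥ (canonD n A)⁻¹ *ᵥ y := by
  simpa using hD.inv.posSemidef.dotProduct_mulVec_nonneg y

theorem score_logLikT (hn : ∀ k, 2 ≤ n k) (hperp : ∀ k, IsPerp (vperp k))
    (hD : (canonD n A).PosDef) {ν : ℝ} (hν : 2 < ν) (z : Var n → ℝ) :
    DifferentiableAt ℝ (logLikT n vperp ν z) (vec A) ∧
      score (logLikT n vperp ν z) (vec A)
        = canonScore n A (W n vperp A ν z) ((canonQ n vperp)ᵀ *ᵥ z) := by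
  have hq := quadForm_inv_canonD_nonneg hD ((canonQ n vperp)ᵀ *ᵥ z)
  have hν2 : 0 < ν - 2 := by linarith
  have hN : (0 : ℝ) ≤ Fintype.card (Var n) := Nat.cast_nonneg _
  rw [W_eq hn hperp hD, quadForm_inv_corrOfA hn hperp]
  refine score_elliptical hD _ (κ := Real.Gamma ((ν + Fintype.card (Var n)) / 2)
      / Real.Gamma (ν / 2) * ((ν - 2) * Real.pi) ^ (-(Fintype.card (Var n) : ℝ) / 2))
    (h := fun q => (1 + 1 / (ν - 2) * q) ^ (-(ν + Fintype.card (Var n)) / 2))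
    ?_ (by positivity) (hasDerivAt_tGenerator hν hq) fun a => ?_
  -- Here `κ` excludes the determinant factor, which is `1` for the identity matrix.
  · have h1 := tNormalizer_pos hν hN (Matrix.PosDef.one (n := Var n) (R := ℝ))
    simpa using h1
  · rw [logLikT, tStdDensity, det_corrOfA hn hperp, quadForm_inv_corrOfA hn hperp]

theorem score_logLikGauss (hn : ∀ k, 2 ≤ n k) (hperp : ∀ k, IsPerp (vperp k))
    (hD : (canonD n A).PosDef) (z : Var n → ℝ) :
    DifferentiableAt ℝ (logLikGauss n vperp z) (vec A) ∧
      score (logLikGauss n vperp z) (vec A)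
        = canonScore n A 1 ((canonQ n vperp)ᵀ *ᵥ z) := by
  refine score_elliptical hD _ (κ := (2 * Real.pi) ^ (-(Fintype.card (Var n) : ℝ) / 2))
    (h := fun q => Real.exp (-(1 / 2) * q)) (by positivity) (by positivity) ?_ fun a => ?_
  · refine ((hasDerivAt_id _).const_mul (-(1 / 2 : ℝ))).exp.congr_deriv ?_
    simp only [id]
    ring
  · rw [logLikGauss, gaussDensity, det_corrOfA hn hperp, quadForm_inv_corrOfA hn hperp]

theorem integrable_comp_and_integral_comp_of_hasLaw {𝓧 Ω : Type*} [MeasurableSpace 𝓧]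
    [MeasurableSpace Ω] {P : Measure Ω} {μ : Measure 𝓧} {Z : Ω → 𝓧} (hZ : HasLaw Z μ P)
    {g : 𝓧 → ℝ} (hg : Integrable g μ) :
    Integrable (fun ω => g (Z ω)) P ∧ ∫ ω, g (Z ω) ∂P = ∫ x, g x ∂μ := by
  refine ⟨?_, hZ.integral_comp hg.aestronglyMeasurable⟩
  rw [← hZ.map_eq] at hg
  exact hg.comp_aemeasurable hZ.aemeasurable

end LogLikelihood

end BlockCorr

/-! ### Score and information matrix of the two models -/

theorem theorem3 {K : ℕ} (n : Fin K → ℕ) (hn : ∀ k, 2 ≤ n k)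
    (vperp : ∀ k, Matrix (Fin (n k)) (Fin (n k - 1)) ℝ) (hperp : ∀ k, IsPerp (vperp k))
    (ρ : Matrix (Fin K) (Fin K) ℝ) (hC : (blockCorr n ρ).PosDef)
    (A : Matrix (Fin K) (Fin K) ℝ) (hA : A = canonA n ρ)
    {Ω : Type*} [MeasurableSpace Ω] (P : Measure Ω) [IsProbabilityMeasure P]
    (Z : Ω → EuclideanSpace ℝ (Var n)) :
    -- multivariate t-distribution: score and information matrix
    (∀ ν : ℝ, 2 < ν → HasLaw Z (tStd ν (blockCorr n ρ)) P →
      (∀ ω, DifferentiableAt ℝ (logLikT n vperp ν (Z ω)) (vec A) ∧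
        score (logLikT n vperp ν (Z ω)) (vec A) =
          (1 / 2 : ℝ) • ((invSqrt A ⊗ₖ invSqrt A) *ᵥ
            (W n vperp A ν (Z ω) • vec (vecMulVec (X0 n vperp A (Z ω)) (X0 n vperp A (Z ω)))
              - vec (1 : Matrix (Fin K) (Fin K) ℝ)))
          + (1 / 2 : ℝ) • ((diagElim K)ᵀ *ᵥ S n vperp A (W n vperp A ν (Z ω)) (Z ω))) ∧
      (∀ p q, Integrable (fun ω => score (logLikT n vperp ν (Z ω)) (vec A) p
          * score (logLikT n vperp ν (Z ω)) (vec A) q) P) ∧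
      (Matrix.of fun p q => ∫ ω, score (logLikT n vperp ν (Z ω)) (vec A) p
          * score (logLikT n vperp ν (Z ω)) (vec A) q ∂P) =
        (1 / 4 : ℝ) • (phi n ν • ((A⁻¹ ⊗ₖ A⁻¹) * HMat K)
            + (phi n ν - 1) • vecMulVec (vec A⁻¹) (vec A⁻¹))
          + (phi n ν / 2) • ((diagElim K)ᵀ * Xi n A * diagElim K)
          + ((1 - phi n ν) / 4) • (vecMulVec (vec A⁻¹) (xi n A) * diagElim K
            + (diagElim K)ᵀ * vecMulVec (xi n A) (vec A⁻¹)
            - (diagElim K)ᵀ * vecMulVec (xi n A) (xi n A) * diagElim K)) ∧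
    -- multivariate Gaussian distribution: `W = φ = 1`
    (HasLaw Z (multivariateGaussian 0 (blockCorr n ρ)) P →
      (∀ ω, DifferentiableAt ℝ (logLikGauss n vperp (Z ω)) (vec A) ∧
        score (logLikGauss n vperp (Z ω)) (vec A) =
          (1 / 2 : ℝ) • ((invSqrt A ⊗ₖ invSqrt A) *ᵥ
            (vec (vecMulVec (X0 n vperp A (Z ω)) (X0 n vperp A (Z ω)))
              - vec (1 : Matrix (Fin K) (Fin K) ℝ)))
          + (1 / 2 : ℝ) • ((diagElim K)ᵀ *ᵥ S n vperp A 1 (Z ω))) ∧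
      (∀ p q, Integrable (fun ω => score (logLikGauss n vperp (Z ω)) (vec A) p
          * score (logLikGauss n vperp (Z ω)) (vec A) q) P) ∧
      (Matrix.of fun p q => ∫ ω, score (logLikGauss n vperp (Z ω)) (vec A) p
          * score (logLikGauss n vperp (Z ω)) (vec A) q ∂P) =
        (1 / 4 : ℝ) • ((A⁻¹ ⊗ₖ A⁻¹) * HMat K)
          + (1 / 2 : ℝ) • ((diagElim K)ᵀ * Xi n A * diagElim K)) := by
  have hCA : blockCorr n ρ = corrOfA n vperp A := hA ▸ blockCorr_eq_corrOfA hn hperp ρ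
  have hD : (canonD n A).PosDef := posDef_canonD_of_corrOfA hn hperp (hCA ▸ hC)
  have hQCQ : (canonQ n vperp)ᵀ * blockCorr n ρ * canonQ n vperp = canonD n A := by
    rw [hCA, transpose_mul_corrOfA_mul hn hperp]
  have hformula := canonScore_eq (vperp := vperp) hn (posDef_of_canonD hD)
    (lam_pos_of_canonD hn hD)
  refine ⟨fun ν hν hZ => ?_, fun hZ => ?_⟩
  · have hsc := fun z => score_logLikT hn hperp hD hν z
    refine ⟨fun ω => ⟨(hsc _).1, (hsc _).2.trans (hformula _ _)⟩, ?_⟩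
    -- Being the law of `Z`, the measure has mass one, so the integral of the t-density need not be
    -- computed.
    have : IsProbabilityMeasure (tStd ν (blockCorr n ρ)) := hZ.isProbabilityMeasure_iff.1 ‹_›
    obtain ⟨h2, e2, h4, e4⟩ := tStd_moments hC (canonQ n vperp) hν
      (w := fun z => W n vperp A ν z) (fun z => by rw [W_eq hn hperp hD, hCA])
    rw [hQCQ] at e2 e4
    obtain ⟨hint, hinfo⟩ := information_of_moments hn hD h2 e2 h4 e4
    have hlaw := fun p q => integrable_comp_and_integral_comp_of_hasLaw hZ (hint p q)
    simp only [(hsc _).2]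
    refine ⟨fun p q => (hlaw p q).1, ?_⟩
    rw [card_var] at hinfo
    simp only [(hlaw _ _).2]
    exact hinfo
  · have hsc := fun z => score_logLikGauss hn hperp hD z
    refine ⟨fun ω => ⟨(hsc _).1, (hsc _).2.trans ((hformula _ _).trans (by rw [one_smul]))⟩, ?_⟩
    obtain ⟨h2, e2, h4, e4⟩ := multivariateGaussian_moments hC.posSemidef (canonQ n vperp)
    rw [hQCQ] at e2 e4
    obtain ⟨hint, hinfo⟩ := information_of_moments hn hD h2 e2 h4 e4
    have hlaw := fun p q => integrable_comp_and_integral_comp_of_hasLaw hZ (hint p q)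
    simp only [(hsc _).2]
    refine ⟨fun p q => (hlaw p q).1, ?_⟩
    simp only [(hlaw _ _).2]
    -- With `φ = 1` the terms carrying `φ - 1` and `1 - φ` vanish.
    simpa using hinfo
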